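/- Let $d\ge 3$ and let $\mathbb{P}^n=\mathbb{P}^n_{\mathbb{C}}$. Let $C\subset\mathbb{P}^3$ be a nonplanar smooth rational curve of degree $d$, properly parametrized (i.e. injectively outside finitely many points) by four binary forms of degree $d$ without common zero, and let $S\subset\mathbb{P}^3$ be its tangent developable, the union of the tangent lines of $C$; $C$ is called the cuspidal curve of $S$. The nodal curve $N$ of $S$ is the Zariski closure of the set of points at which $S$ has exactly two local analytic branches, both smooth and meeting transversally (local equation $xy=0$). Assume that $S$ is \emph{good}, that is: \begin{itemize} \item $S$ is smooth outside $C\cup N$; \item $N$ is irreducible (or empty), and every point of $N\setminus C$ is a smooth point or an ordinary triple point of $N$; \item at every point of $C\cap N$ there are local analytic coordinates $x,y,z$ of $\mathbb{P}^3$ centred at the point in which either $S$ is $(x^2-y^3)z=0$, $C$ is $x=y=0$ and $N$ is $x^2-y^3=z=0$, or $S$ is $z^2y^3-x^2=0$, $C$ is $x=y=0$ and $N$ is $x=z=0$; in the latter case the point is called a \emph{cuspidal pinch point}; \item there are exactly $4(d-3)$ cuspidal pinch points. \end{itemize} Let $\pi\colon\mathbb{P}^3\dashrightarrow\mathbb{P}^2$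 be the linear projection from a general point (that is, from any point outside a suitable surface in $\mathbb{P}^3$ depending only on $S$). Let $H_0,H_1,H_2\in\mathbb{C}[t_0,t_1]$ be any forms of degree $d$ without common zero such that $(H_0:H_1:H_2)$ is a proper parametrization of the plane curve $\pi(C)$. Let $T\subset\mathbb{P}^2$ be the set of images under $\pi$ of the cuspidal pinch points of $S$. Let $V$ be the vector space of all forms $H_3\in\mathbb{C}[t_0,t_1]$ of degree $d$ such that \[ \det\begin{pmatrix} \frac{\partial^3 H_0}{\partial t_0^3} & \frac{\partial^3 H_0}{\partial t_0^2\partial t_1} & \frac{\partial^3 H_0}{\partial t_0\partial t_1^2} & \frac{\partial^3 H_0}{\partial t_1^3}\\ \vdots&\vdots&\vdots&\vdots\\ \frac{\partial^3 H_3}{\partial t_0^3} & \frac{\partial^3 H_3}{\partial t_0^2\partial t_1} & \frac{\partial^3 H_3}{\partial t_0\partial t_1^2} & \frac{\partial^3 H_3}{\partial t_1^3} \end{pmatrix} \] vanishes at all parameters $(t_0:t_1)$ with $(H_0:H_1:H_2)(t_0:t_1)\in T$; this is a system of linear equations in the coefficients of $H_3$. Then $T$ consists of exactly $4(d-3)$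 points, and $\dim_{\mathbb{C}}V=4$. Moreover, for every $H_3\in V$ that is not a linear combination of $H_0,H_1,H_2$ there is a projective transformation $g$ of $\mathbb{P}^3$ such that $g$ followed by the projection $(x_0:x_1:x_2:x_3)\mapsto(x_0:x_1:x_2)$ equals $\pi$, and such that $g$ maps $C$ onto the curve parametrized by $(H_0:H_1:H_2:H_3)$ and $S$ onto the tangent developable of that curve. Thus the cuspidal curve, and with it the tangent developable, is determined by the algorithm up to projective transformations compatible with the projections to $\mathbb{P}^2$, which therefore preserve the silhouette. -/

import Mathlib

open scoped Topology

namespace TangentDev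

open MvPolynomial

/-- Complex projective `n`-space. -/
abbrev PSpace (n : ℕ) : Type := Projectivization ℂ (Fin (n + 1) → ℂ)

/-- The nonzero vector `v` is a vector of homogeneous coordinates of the point `p`. -/
def Represents {n : ℕ} (v : Fin (n + 1) → ℂ) (p : PSpace n) : Prop :=
  ∃ hv : v ≠ 0, Projectivization.mk ℂ v hv = p

/-! ### Parametrized rational curves -/

/-- The value at `τ` of a tuple of polynomials in the two variables `t₀, t₁`. -/
noncomputable def evalAt {n : ℕ} (γ : Fin (n + 1) → MvPolynomial (Fin 2) ℂ) (τ : Fin 2 → ℂ) :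
    Fin (n + 1) → ℂ :=
  fun i => eval τ (γ i)

/-- The value at `τ` of the partial derivative `∂γ/∂t_k`. -/
noncomputable def partialAt {n : ℕ} (γ : Fin (n + 1) → MvPolynomial (Fin 2) ℂ) (k : Fin 2)
    (τ : Fin 2 → ℂ) : Fin (n + 1) → ℂ :=
  fun i => eval τ (pderiv k (γ i))

/-- `γ = (γ₀ : … : γₙ)` is a (proper) parametrization by forms of degree `d` of a rational curve
of degree `d` in projective `n`-space: the forms have no common zero on the projective line and
the resulting map is injective outside finitely many points. -/
structure IsParametrization (d : ℕ) {n : ℕ} (γ : Fin (n + 1) → MvPolynomial (Fin 2) ℂ) :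
    Prop where
  homogeneous : ∀ i, (γ i).IsHomogeneous d
  base_point_free : ∀ τ : Fin 2 → ℂ, τ ≠ 0 → evalAt γ τ ≠ 0
  generically_injective :
    {t : PSpace 1 | ∃ t' : PSpace 1, t' ≠ t ∧ ∃ p : PSpace n,
      Represents (evalAt γ t.rep) p ∧ Represents (evalAt γ t'.rep) p}.Finite

/-- The curve in projective `n`-space parametrized by `γ`. -/
def curve {n : ℕ} (γ : Fin (n + 1) → MvPolynomial (Fin 2) ℂ) : Set (PSpace n) :=
  {p | ∃ τ : Fin 2 → ℂ, τ ≠ 0 ∧ Represents (evalAt γ τ) p}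

/-- The union of the tangent lines of the curve parametrized by `γ`. The tangent line at the
parameter `τ` is spanned by the two partial derivatives of `γ` at `τ`. -/
def tangentDevelopable {n : ℕ} (γ : Fin (n + 1) → MvPolynomial (Fin 2) ℂ) : Set (PSpace n) :=
  {p | ∃ τ : Fin 2 → ℂ, τ ≠ 0 ∧ ∃ a b : ℂ,
    Represents (a • partialAt γ 0 τ + b • partialAt γ 1 τ) p}

/-- `γ` is a closed embedding of the projective line (it is injective with injective
differential), so that the curve it parametrizes is smooth. -/
structure IsEmbedding {n : ℕ} (γ : Fin (n + 1) → MvPolynomial (Fin 2) ℂ) : Prop where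
  injective : ∀ t t' : PSpace 1, ∀ p : PSpace n,
    Represents (evalAt γ t.rep) p → Represents (evalAt γ t'.rep) p → t = t'
  immersive : ∀ τ : Fin 2 → ℂ, τ ≠ 0 →
    LinearIndependent ℂ ![partialAt γ 0 τ, partialAt γ 1 τ]

/-! ### Zariski closure and irreducibility -/

/-- The homogeneous polynomial `F` vanishes on the set `X` of points. -/
def VanishesOn {n : ℕ} (F : MvPolynomial (Fin (n + 1)) ℂ) (X : Set (PSpace n)) : Prop :=
  ∀ p ∈ X, eval p.rep F = 0

/-- The Zariski closure of a set of points of projective space. -/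
def zariskiClosure {n : ℕ} (X : Set (PSpace n)) : Set (PSpace n) :=
  {p | ∀ (F : MvPolynomial (Fin (n + 1)) ℂ) (k : ℕ), F.IsHomogeneous k →
    VanishesOn F X → eval p.rep F = 0}

/-- `X` is irreducible in the Zariski topology (the empty set is allowed): a product of two
homogeneous polynomials vanishes on `X` only if one of the factors does. -/
def IsIrreducibleOrEmpty {n : ℕ} (X : Set (PSpace n)) : Prop :=
  ∀ (F G : MvPolynomial (Fin (n + 1)) ℂ) (k l : ℕ), F.IsHomogeneous k → G.IsHomogeneous l →
    VanishesOn (F * G) X → VanishesOn F X ∨ VanishesOn G X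

/-! ### Local analytic normal forms in projective 3-space -/

/-- `Φ`, read modulo scalars, is a system of local analytic coordinates (more precisely the inverse
of one) of projective 3-space centred at `p`: a map germ that is analytic at the origin, sends the
origin to `p`, and induces a local isomorphism to projective 3-space. -/
structure IsLocalCoordinates (p : PSpace 3) (Φ : (Fin 3 → ℂ) → (Fin 4 → ℂ)) : Prop where
  analytic : AnalyticAt ℂ Φ 0
  center : Represents (Φ 0) p
  nondegenerate : ∀ (c : ℂ) (x : Fin 3 → ℂ), c • Φ 0 + fderiv ℂ Φ 0 x = 0 → c = 0 ∧ x = 0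

/-- In the local coordinates `Φ`, the set `X` coincides near the origin with `Z`. -/
def HasLocalForm (Φ : (Fin 3 → ℂ) → (Fin 4 → ℂ)) (X : Set (PSpace 3)) (Z : Set (Fin 3 → ℂ)) :
    Prop :=
  ∀ᶠ x in 𝓝 (0 : Fin 3 → ℂ), (∃ p ∈ X, Represents (Φ x) p) ↔ x ∈ Z

/-- The surface `S` is smooth at `p`. -/
def IsSmoothSurfaceAt (S : Set (PSpace 3)) (p : PSpace 3) : Prop :=
  ∃ Φ, IsLocalCoordinates p Φ ∧ HasLocalForm Φ S {x | x 0 = 0}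

/-- The surface `S` has two branches at `p`, both smooth, that intersect transversally. -/
def IsNodeAt (S : Set (PSpace 3)) (p : PSpace 3) : Prop :=
  ∃ Φ, IsLocalCoordinates p Φ ∧ HasLocalForm Φ S {x | x 0 * x 1 = 0}

/-- The nodal curve of the surface `S`: the Zariski closure of the set of points at which the
surface has two transversal branches. -/
def nodalCurve (S : Set (PSpace 3)) : Set (PSpace 3) :=
  zariskiClosure {p | IsNodeAt S p}

/-- The curve `N` is smooth at `p`. -/
def IsSmoothCurveAt (N : Set (PSpace 3)) (p : PSpace 3) : Prop :=
  ∃ Φ, IsLocalCoordinates p Φ ∧ HasLocalForm Φ N {x | x 0 = 0 ∧ x 1 = 0}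

/-- The curve `N` has an ordinary triple point at `p`: three smooth branches with distinct
tangents, which in suitable analytic coordinates are three distinct lines through the origin. -/
def IsOrdinaryTriplePointAt (N : Set (PSpace 3)) (p : PSpace 3) : Prop :=
  ∃ w : Fin 3 → Fin 3 → ℂ, (∀ i j, i ≠ j → LinearIndependent ℂ ![w i, w j]) ∧
    ∃ Φ, IsLocalCoordinates p Φ ∧
      HasLocalForm Φ N {x | ∃ (i : Fin 3) (c : ℂ), x = c • w i}

/-- A point at which the surface `S` with cuspidal curve `C` and nodal curve `N` has the local
equation `(x² - y³) z = 0`, with `C` given by `x = y = 0` and `N` by `x² - y³ = z = 0`. -/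
def IsCuspidalIntersection (S C N : Set (PSpace 3)) (p : PSpace 3) : Prop :=
  ∃ Φ, IsLocalCoordinates p Φ ∧
    HasLocalForm Φ S {x | (x 0 ^ 2 - x 1 ^ 3) * x 2 = 0} ∧
    HasLocalForm Φ C {x | x 0 = 0 ∧ x 1 = 0} ∧
    HasLocalForm Φ N {x | x 0 ^ 2 - x 1 ^ 3 = 0 ∧ x 2 = 0}

/-- A cuspidal pinch point of the surface `S` with cuspidal curve `C` and nodal curve `N`: the
surface has the local equation `z² y³ - x² = 0`, and `C`, given by `x = y = 0`, and `N`, given by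
`x = z = 0`, intersect transversally. -/
def IsCuspidalPinchPoint (S C N : Set (PSpace 3)) (p : PSpace 3) : Prop :=
  ∃ Φ, IsLocalCoordinates p Φ ∧
    HasLocalForm Φ S {x | x 2 ^ 2 * x 1 ^ 3 - x 0 ^ 2 = 0} ∧
    HasLocalForm Φ C {x | x 0 = 0 ∧ x 1 = 0} ∧
    HasLocalForm Φ N {x | x 0 = 0 ∧ x 2 = 0}

/-! ### Good tangent developables -/

/-- The nodal curve of the tangent developable of `γ`. -/
def nodalCurveOf (γ : Fin 4 → MvPolynomial (Fin 2) ℂ) : Set (PSpace 3) :=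
  nodalCurve (tangentDevelopable (n := 3) γ)

/-- The set of cuspidal pinch points of the tangent developable of `γ`. -/
def cuspidalPinchPoints (γ : Fin 4 → MvPolynomial (Fin 2) ℂ) : Set (PSpace 3) :=
  {p | IsCuspidalPinchPoint (tangentDevelopable (n := 3) γ) (curve (n := 3) γ)
    (nodalCurveOf γ) p}

/-- The tangent developable of the rational space curve of degree `d` parametrized by `γ` is
good. -/
structure IsGood (d : ℕ) (γ : Fin 4 → MvPolynomial (Fin 2) ℂ) : Prop where
  parametrization : IsParametrization (n := 3) d γ
  /-- the curve is not contained in a plane -/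
  nondegenerate : LinearIndependent ℂ γ
  /-- the cuspidal curve is smooth (and irreducible, as the image of the projective line) -/
  cuspidal_smooth : IsEmbedding (n := 3) γ
  singularities : ∀ p ∈ tangentDevelopable (n := 3) γ, p ∉ curve (n := 3) γ →
    p ∉ nodalCurveOf γ → IsSmoothSurfaceAt (tangentDevelopable (n := 3) γ) p
  nodal_irreducible : IsIrreducibleOrEmpty (nodalCurveOf γ)
  nodal_singularities : ∀ p ∈ nodalCurveOf γ, p ∉ curve (n := 3) γ →
    IsSmoothCurveAt (nodalCurveOf γ) p ∨ IsOrdinaryTriplePointAt (nodalCurveOf γ) p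
  intersections : ∀ p ∈ nodalCurveOf γ, p ∈ curve (n := 3) γ →
    IsCuspidalIntersection (tangentDevelopable (n := 3) γ) (curve (n := 3) γ)
      (nodalCurveOf γ) p ∨ p ∈ cuspidalPinchPoints γ
  card_pinch : (cuspidalPinchPoints γ).encard = ((4 * (d - 3) : ℕ) : ℕ∞)

/-! ### Projection to the plane and the linear system -/

/-- The image of a set of points under the linear projection from projective 3-space to the
projective plane induced by `A`. -/
def projImage (A : (Fin 4 → ℂ) →ₗ[ℂ] (Fin 3 → ℂ)) (X : Set (PSpace 3)) : Set (PSpace 2) :=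
  {q | ∃ p ∈ X, ∃ v : Fin 4 → ℂ, Represents (n := 3) v p ∧ Represents (n := 2) (A v) q}

/-- The `4 × 4` matrix whose row `i` consists of the third partial derivatives
`∂³f_i/∂t₀³, ∂³f_i/∂t₀²∂t₁, ∂³f_i/∂t₀∂t₁², ∂³f_i/∂t₁³`. -/
noncomputable def thirdDerivMatrix (f : Fin 4 → MvPolynomial (Fin 2) ℂ) :
    Matrix (Fin 4) (Fin 4) (MvPolynomial (Fin 2) ℂ) :=
  fun i j => (pderiv 0)^[3 - (j : ℕ)] ((pderiv 1)^[(j : ℕ)] (f i))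

/-- The four polynomials `H₀, H₁, H₂, h`. -/
def extend (H : Fin 3 → MvPolynomial (Fin 2) ℂ) (h : MvPolynomial (Fin 2) ℂ) :
    Fin 4 → MvPolynomial (Fin 2) ℂ :=
  ![H 0, H 1, H 2, h]

theorem iterate_pderiv_smul (k : Fin 2) (m : ℕ) (c : ℂ) (a : MvPolynomial (Fin 2) ℂ) :
    (pderiv k)^[m] (c • a) = c • (pderiv k)^[m] a := by
  induction m with
  | zero => rfl
  | succ m ih =>
    simp only [Function.iterate_succ_apply', ih]
    exact Derivation.map_smul _ _ _

theorem thirdDerivMatrix_updateRow (H : Fin 3 → MvPolynomial (Fin 2) ℂ)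
    (h h' : MvPolynomial (Fin 2) ℂ) :
    thirdDerivMatrix (extend H h) = (thirdDerivMatrix (extend H h')).updateRow 3
      (fun j => (pderiv 0)^[3 - (j : ℕ)] ((pderiv 1)^[(j : ℕ)] h)) := by
  ext1 i j
  fin_cases i <;> simp [thirdDerivMatrix, extend, Matrix.updateRow_apply]

/-- The determinant of the third-derivative matrix of `H₀, H₁, H₂, h` is linear in `h`. -/
theorem det_add (H : Fin 3 → MvPolynomial (Fin 2) ℂ) (a b : MvPolynomial (Fin 2) ℂ) :
    (thirdDerivMatrix (extend H (a + b))).det =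
      (thirdDerivMatrix (extend H a)).det + (thirdDerivMatrix (extend H b)).det := by
  rw [thirdDerivMatrix_updateRow H (a + b) 0, thirdDerivMatrix_updateRow H a 0,
    thirdDerivMatrix_updateRow H b 0, ← Matrix.det_updateRow_add]
  congr 2
  ext1 j
  simp

theorem det_smul (H : Fin 3 → MvPolynomial (Fin 2) ℂ) (c : ℂ) (a : MvPolynomial (Fin 2) ℂ) :
    (thirdDerivMatrix (extend H (c • a))).det = c • (thirdDerivMatrix (extend H a)).det := by
  rw [thirdDerivMatrix_updateRow H (c • a) 0, thirdDerivMatrix_updateRow H a 0,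
    MvPolynomial.smul_eq_C_mul (Matrix.det _) c, ← Matrix.det_updateRow_smul]
  congr 2
  ext1 j
  rw [iterate_pderiv_smul, iterate_pderiv_smul, MvPolynomial.smul_eq_C_mul]
  rfl

/-- The solution space of the linear system for the fourth polynomial: the forms `h` of degree `d`
for which the determinant of the matrix of third derivatives of `H₀, H₁, H₂, h` vanishes at all
parameters of the points of `T` on the plane curve `(H₀ : H₁ : H₂)`. -/
noncomputable def solutionSpace (d : ℕ) (H : Fin 3 → MvPolynomial (Fin 2) ℂ)
    (T : Set (PSpace 2)) : Submodule ℂ (MvPolynomial (Fin 2) ℂ) where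
  carrier := {h | h.IsHomogeneous d ∧ ∀ τ : Fin 2 → ℂ,
    (∃ q ∈ T, Represents (evalAt (n := 2) H τ) q) →
      eval τ (thirdDerivMatrix (extend H h)).det = 0}
  add_mem' := by
    rintro a b ⟨ha, ha'⟩ ⟨hb, hb'⟩
    refine ⟨ha.add hb, fun τ hτ => ?_⟩
    rw [det_add, map_add, ha' τ hτ, hb' τ hτ, add_zero]
  zero_mem' := by
    refine ⟨isHomogeneous_zero _ _ _, fun τ _ => ?_⟩
    have h0 := det_smul H 0 0
    rw [zero_smul, zero_smul] at h0
    rw [h0, map_zero]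
  smul_mem' := by
    rintro c a ⟨ha, ha'⟩
    refine ⟨(homogeneousSubmodule (Fin 2) ℂ d).smul_mem c ha, fun τ hτ => ?_⟩
    rw [det_smul, smul_eval, ha' τ hτ, mul_zero]

/-- The image of a set of points under the projective transformation of projective 3-space induced
by the linear automorphism `g`. -/
def transform (g : (Fin 4 → ℂ) ≃ₗ[ℂ] (Fin 4 → ℂ)) (X : Set (PSpace 3)) : Set (PSpace 3) :=
  Projectivization.map g.toLinearMap g.injective '' X

end TangentDev

namespace TangentDev

open MvPolynomial

/-! ### Homogeneous coordinates -/

/-! For four binary forms `f` of degree `d`, let `W(f)` be the determinant of their third partial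
derivatives, a binary form of degree `4(d - 3)`. By Euler's relation it plays the part of the
Wronskian: it is not the zero form when the `f i` are linearly independent
(`not_linearIndependent_of_det_eq_zero`). It vanishes at a parameter where some plane meets the
curve to order at least four.

A cuspidal pinch point is such a point (`det_eq_zero_of_pinch`). If `ℓ` is the linear part of the
local coordinate `x`, then `ℓ` vanishes to order two along the curve, and the local equation `x² =
z²y³`, tested on a suitable arc of the tangent developable, raises the order to four. Since there
are `4(d - 3)` pinch points, with distinct parameters, they exhaust the zeros of `W(f)`.

The centre is kept off the cones over `C` with vertices at the pinch points (`exists_cone`), so that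
no other point of `C` has the same image as a pinch point. Any two proper parametrizations of the
plane curve differ by a linear change of parameter (`exists_linSub_eq`). After moving that change
into `γ`, one has `H = A ∘ f` exactly.

The linear system is then solved as follows. If `h` is a combination of the `f j`, then `W(H, h)` is
a constant times `W(f)`, hence `h` is a solution. Conversely, for a solution `h` the forms `W(H, h)`
and `W(f)` have the same degree and share as many zeros as that degree, so they are proportional. As
`W(H, ·)` is linear, subtracting a suitable combination `η` of the `f j` makes it zero; then `h - η`
lies in the span of `H`, and `h` in the span of `f`. The solution space is therefore the
four-dimensional span of `f`, and a solution outside the span of `H` completes `A` to an invertible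
matrix. -/

theorem represents_iff {n : ℕ} {v : Fin (n + 1) → ℂ} {p : PSpace n} :
    Represents v p ↔ ∃ c : ℂ, c ≠ 0 ∧ v = c • p.rep := by
  constructor
  · rintro ⟨hv, rfl⟩
    obtain ⟨a, ha⟩ := Projectivization.exists_smul_eq_mk_rep ℂ v hv
    refine ⟨(a⁻¹ : ℂˣ), Units.ne_zero _, ?_⟩
    rw [← ha]
    exact (inv_smul_smul a v).symm
  · rintro ⟨c, hc, rfl⟩
    refine ⟨smul_ne_zero hc p.rep_nonzero, ?_⟩
    conv_rhs => rw [← p.mk_rep]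
    exact (Projectivization.mk_eq_mk_iff' ℂ _ _ _ _).2 ⟨c, rfl⟩

theorem Represents.ne_zero {n : ℕ} {v : Fin (n + 1) → ℂ} {p : PSpace n} (h : Represents v p) :
    v ≠ 0 := h.1

theorem Represents.eq {n : ℕ} {v : Fin (n + 1) → ℂ} {p q : PSpace n} (h : Represents v p)
    (h' : Represents v q) : p = q := by
  obtain ⟨hv, rfl⟩ := h
  obtain ⟨hw, rfl⟩ := h'
  rfl

theorem Represents.smul {n : ℕ} {v : Fin (n + 1) → ℂ} {p : PSpace n} (h : Represents v p)
    {c : ℂ} (hc : c ≠ 0) : Represents (c • v) p := by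
  obtain ⟨a, ha, rfl⟩ := represents_iff.1 h
  exact represents_iff.2 ⟨c * a, mul_ne_zero hc ha, by rw [mul_smul]⟩

theorem Represents.exists_smul {n : ℕ} {v w : Fin (n + 1) → ℂ} {p : PSpace n}
    (h : Represents v p) (h' : Represents w p) : ∃ c : ℂ, c ≠ 0 ∧ w = c • v := by
  obtain ⟨a, ha, rfl⟩ := represents_iff.1 h
  obtain ⟨b, hb, rfl⟩ := represents_iff.1 h'
  refine ⟨b / a, div_ne_zero hb ha, ?_⟩
  rw [smul_smul, div_mul_cancel₀ _ ha]

theorem represents_mk {n : ℕ} {v : Fin (n + 1) → ℂ} (hv : v ≠ 0) :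
    Represents v (Projectivization.mk ℂ v hv) := ⟨hv, rfl⟩

theorem represents_rep {n : ℕ} (p : PSpace n) : Represents p.rep p :=
  ⟨p.rep_nonzero, p.mk_rep⟩

/-! ### Binary forms -/

theorem eval_smul_of_isHomogeneous {σ : Type*} {F : MvPolynomial σ ℂ} {n : ℕ}
    (hF : F.IsHomogeneous n) (c : ℂ) (v : σ → ℂ) : eval (c • v) F = c ^ n * eval v F := by
  rw [eval_eq, eval_eq, Finset.mul_sum]
  refine Finset.sum_congr rfl fun m hm => ?_
  have h := hF.degree_eq_sum_deg_support hm
  simp only [Pi.smul_apply, smul_eq_mul, mul_pow, Finset.prod_mul_distrib]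
  rw [Finset.prod_pow_eq_pow_sum, ← h]
  ring

theorem evalAt_smul {d n : ℕ} {γ : Fin (n + 1) → MvPolynomial (Fin 2) ℂ}
    (hγ : ∀ i, (γ i).IsHomogeneous d) (c : ℂ) (τ : Fin 2 → ℂ) :
    evalAt γ (c • τ) = c ^ d • evalAt γ τ := by
  ext i
  simp [evalAt, eval_smul_of_isHomogeneous (hγ i)]

theorem euler_eval {F : MvPolynomial (Fin 2) ℂ} {n : ℕ} (hF : F.IsHomogeneous n)
    (τ : Fin 2 → ℂ) :
    τ 0 * eval τ (pderiv 0 F) + τ 1 * eval τ (pderiv 1 F) = n * eval τ F := by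
  have h := congrArg (eval τ) hF.sum_X_mul_pderiv
  simpa using h

/-- A binary form of degree `n` that vanishes at `n + 1` points of the projective line is zero. -/
theorem eq_zero_of_card_roots {F : MvPolynomial (Fin 2) ℂ} {n : ℕ} (hF : F.IsHomogeneous n)
    {ι : Type*} (s : Finset ι) (hs : n < s.card) (τ : ι → Fin 2 → ℂ)
    (hτ : ∀ i ∈ s, τ i ≠ 0)
    (hinj : ∀ i ∈ s, ∀ j ∈ s, ∀ c : ℂ, τ i = c • τ j → i = j)
    (h0 : ∀ i ∈ s, eval (τ i) F = 0) : F = 0 := by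
  classical
  -- The line `t₁ - y t₀ = 1` meets every direction except `(1 : y)`. If `y` is not the slope of a
  -- root, all roots have representatives on it, so the restriction of `F`, of degree at most `n`,
  -- has more than `n` zeros. A root with `τ i 0 = 0` contributes the default slope `0`, which only
  -- excludes one more `y`.
  have key : ∀ y ∉ s.image (fun i => τ i 1 / τ i 0), ∀ z : ℂ,
      eval ![z, 1 + y * z] F = 0 := by
    intro y hy z
    have hne : ∀ i ∈ s, τ i 1 - y * τ i 0 ≠ 0 := by
      intro i hi h
      by_cases h00 : τ i 0 = 0
      · apply hτ i hi
        ext k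
        fin_cases k
        · exact h00
        · simpa [h00] using h
      · exact hy (Finset.mem_image.2 ⟨i, hi, by field_simp; linear_combination h⟩)
    set f : Fin 2 → Polynomial ℂ := ![Polynomial.X, 1 + Polynomial.C y * Polynomial.X] with hf
    have hev : ∀ z, (aeval f F).eval z = eval ![z, 1 + y * z] F := by
      intro z
      rw [← Polynomial.coe_evalRingHom, aeval_def, hom_eval₂, eval, coe_eval₂Hom]
      congr 1
      · ext; simp
      · ext k
        fin_cases k <;> simp [hf]
    have hdeg : (aeval f F).natDegree ≤ n := by
      have := aeval_natDegree_le (n := 1) F hF.totalDegree_le f (fun i => by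
        fin_cases i <;> simp only [hf] <;> simp
        compute_degree)
      simpa using this
    have hz : aeval f F = 0 := by
      set S := s.image (fun i => τ i 0 / (τ i 1 - y * τ i 0)) with hS
      have hcoord : ∀ i ∈ s, τ i = (τ i 1 - y * τ i 0) •
          ![τ i 0 / (τ i 1 - y * τ i 0), 1 + y * (τ i 0 / (τ i 1 - y * τ i 0))] := by
        intro i hi
        have := hne i hi
        have e : (τ i 1 - y * τ i 0) * (τ i 0 / (τ i 1 - y * τ i 0)) = τ i 0 :=
          mul_div_cancel₀ _ this
        ext k
        fin_cases k
        · exact e.symm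
        · change τ i 1 = (τ i 1 - y * τ i 0) * (1 + y * (τ i 0 / (τ i 1 - y * τ i 0)))
          linear_combination (-y) * e
      have hcard : S.card = s.card := by
        apply Finset.card_image_of_injOn
        intro i hi j hj hij
        refine hinj i hi j hj ((τ i 1 - y * τ i 0) / (τ j 1 - y * τ j 0)) ?_
        have h1 := hcoord i hi
        have h2 := hcoord j hj
        simp only at hij
        rw [hij] at h1
        refine h1.trans (Eq.trans ?_ (congrArg
          (fun w => ((τ i 1 - y * τ i 0) / (τ j 1 - y * τ j 0)) • w) h2.symm))
        rw [smul_smul, div_mul_cancel₀ _ (hne j hj)]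
      refine Polynomial.eq_zero_of_natDegree_lt_card_of_eval_eq_zero' _ S ?_ (by omega)
      intro z hz
      obtain ⟨i, hi, rfl⟩ := Finset.mem_image.1 hz
      rw [hev]
      have h := h0 i hi
      rw [hcoord i hi, eval_smul_of_isHomogeneous hF] at h
      exact (mul_eq_zero.1 h).resolve_left (pow_ne_zero _ (hne i hi))
    rw [← hev, hz, Polynomial.eval_zero]
  have hX : F * X 0 = 0 := by
    refine MvPolynomial.funext fun v => ?_
    rw [map_mul, map_zero, eval_X]
    by_cases hv : v 0 = 0
    · rw [hv, mul_zero]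
    obtain ⟨y, hy⟩ := Infinite.exists_notMem_finset
      (insert (v 1 / v 0) (s.image (fun i => τ i 1 / τ i 0)))
    rw [Finset.mem_insert, not_or] at hy
    have hμ : v 1 - y * v 0 ≠ 0 := by
      intro h
      exact hy.1 (by field_simp; linear_combination -h)
    have e : (v 1 - y * v 0) * (v 0 / (v 1 - y * v 0)) = v 0 := mul_div_cancel₀ _ hμ
    have hv' : v = (v 1 - y * v 0) • ![v 0 / (v 1 - y * v 0), 1 + y * (v 0 / (v 1 - y * v 0))] := by
      ext k
      fin_cases k
      · exact e.symm
      · change v 1 = (v 1 - y * v 0) * (1 + y * (v 0 / (v 1 - y * v 0)))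
        linear_combination (-y) * e
    rw [hv', eval_smul_of_isHomogeneous hF, key y hy.2, mul_zero, zero_mul]
  exact (mul_eq_zero.1 hX).resolve_right (X_ne_zero 0)

/-- Two binary forms of degree `n` that vanish at the same `n` points are proportional. -/
theorem exists_eq_smul_of_card_roots {F G : MvPolynomial (Fin 2) ℂ} {n : ℕ}
    (hF : F.IsHomogeneous n) (hG : G.IsHomogeneous n) (hF0 : F ≠ 0)
    {ι : Type*} (s : Finset ι) (hs : s.card = n) (τ : ι → Fin 2 → ℂ)
    (hτ : ∀ i ∈ s, τ i ≠ 0)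
    (hinj : ∀ i ∈ s, ∀ j ∈ s, ∀ c : ℂ, τ i = c • τ j → i = j)
    (hF' : ∀ i ∈ s, eval (τ i) F = 0) (hG' : ∀ i ∈ s, eval (τ i) G = 0) :
    ∃ c : ℂ, G = c • F := by
  classical
  -- The factor `X 0` forces `v ≠ 0`, which nonvanishing of `F` alone would not do in degree zero.
  obtain ⟨v, hv⟩ : ∃ v, eval v (F * X 0) ≠ 0 := by
    by_contra! h
    refine mul_ne_zero hF0 (X_ne_zero 0) (MvPolynomial.funext fun v => ?_)
    rw [h v, map_zero]
  rw [map_mul, eval_X] at hv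
  have hvF := left_ne_zero_of_mul hv
  have hv0 : v ≠ 0 := fun h => right_ne_zero_of_mul hv (by rw [h]; rfl)
  -- With this constant `G - c F` also vanishes at `v`, which is not proportional to any of the
  -- given roots: `n + 1` zeros in degree `n`.
  refine ⟨eval v G / eval v F, sub_eq_zero.1 ?_⟩
  refine eq_zero_of_card_roots (n := n)
    (hG.sub ((homogeneousSubmodule (Fin 2) ℂ n).smul_mem _ hF)) (Finset.insertNone s)
    (by simp [hs]) (fun o => o.elim v τ) ?_ ?_ ?_
  · rintro (_ | i) hi
    · exact hv0
    · exact hτ i (by simpa using hi)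
  · have hmul : ∀ i ∈ s, ∀ c : ℂ, v ≠ c • τ i := by
      rintro i hi c rfl
      rw [eval_smul_of_isHomogeneous hF, hF' i hi, mul_zero] at hvF
      exact hvF rfl
    rintro (_ | i) hi (_ | j) hj c hc
    · rfl
    · exact absurd hc (hmul j (by simpa using hj) c)
    · have hi' : i ∈ s := by simpa using hi
      have hc0 : c ≠ 0 := by
        rintro rfl
        exact hτ i hi' (by simpa using hc)
      refine absurd ?_ (hmul i hi' c⁻¹)
      change τ i = c • v at hc
      rw [hc, inv_smul_smul₀ hc0]
    · rw [hinj i (by simpa using hi) j (by simpa using hj) c hc]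
  · rintro (_ | i) hi
    · simp [smul_eval, hvF]
    · have hi' : i ∈ s := by simpa using hi
      simp [smul_eval, hF' i hi', hG' i hi']

/-! ### The Wronskian criterion for linear dependence -/

/-- The hypothesis says `(g / f)' = 0`. Comparing leading coefficients, a nonzero solution has the
degree of `f`; subtracting the multiple of `f` that cancels the coefficient in that degree leaves a
solution that can only be zero. -/
theorem exists_eq_C_mul_of_mul_derivative_eq {f g : Polynomial ℂ} (hf : f ≠ 0)
    (h : f * Polynomial.derivative g = Polynomial.derivative f * g) :
    ∃ k : ℂ, g = Polynomial.C k * f := by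
  have key : ∀ g : Polynomial ℂ, g ≠ 0 →
      f * Polynomial.derivative g = Polynomial.derivative f * g → g.natDegree = f.natDegree := by
    intro g hg h
    have hc := congrArg (fun p => Polynomial.coeff p (f.natDegree + g.natDegree - 1)) h
    by_contra hne
    rcases Nat.eq_zero_or_pos g.natDegree with h0 | hpos
    · obtain ⟨a, rfl⟩ := Polynomial.natDegree_eq_zero.1 h0
      have ha : Polynomial.C a ≠ 0 := hg
      have : Polynomial.derivative f = 0 := by
        rcases mul_eq_zero.1 (h.symm.trans (by simp)) with h' | h'
        · exact h'
        · exact absurd h' ha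
      exact hne (by rw [Polynomial.derivative_eq_zero.1 this, h0])
    rcases Nat.eq_zero_or_pos f.natDegree with h0 | hpos'
    · obtain ⟨a, rfl⟩ := Polynomial.natDegree_eq_zero.1 h0
      have : Polynomial.derivative g = 0 := by
        rcases mul_eq_zero.1 (h.trans (by simp)) with h' | h'
        · exact absurd h' hf
        · exact h'
      exact hne (by rw [Polynomial.derivative_eq_zero.1 this, h0])
    have e1 : (f * Polynomial.derivative g).coeff (f.natDegree + g.natDegree - 1) =
        f.leadingCoeff * (g.leadingCoeff * g.natDegree) := by
      rw [show f.natDegree + g.natDegree - 1 = f.natDegree + (g.natDegree - 1) by omega,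
        Polynomial.coeff_mul_add_eq_of_natDegree_le le_rfl (Polynomial.natDegree_derivative_le g),
        Polynomial.coeff_derivative]
      have : ((g.natDegree - 1 : ℕ) : ℂ) + 1 = g.natDegree := by
        rw [← Nat.cast_succ]; congr 1; omega
      rw [this, Nat.sub_add_cancel hpos]
      rfl
    have e2 : (Polynomial.derivative f * g).coeff (f.natDegree + g.natDegree - 1) =
        (f.leadingCoeff * f.natDegree) * g.leadingCoeff := by
      rw [show f.natDegree + g.natDegree - 1 = (f.natDegree - 1) + g.natDegree by omega,
        Polynomial.coeff_mul_add_eq_of_natDegree_le (Polynomial.natDegree_derivative_le f) le_rfl,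
        Polynomial.coeff_derivative]
      have : ((f.natDegree - 1 : ℕ) : ℂ) + 1 = f.natDegree := by
        rw [← Nat.cast_succ]; congr 1; omega
      rw [this, Nat.sub_add_cancel hpos']
      rfl
    simp only [e1, e2] at hc
    have hl : f.leadingCoeff * g.leadingCoeff ≠ 0 :=
      mul_ne_zero (Polynomial.leadingCoeff_ne_zero.2 hf) (Polynomial.leadingCoeff_ne_zero.2 hg)
    have : (g.natDegree : ℂ) = f.natDegree := mul_left_cancel₀ hl (by linear_combination hc)
    exact hne (by exact_mod_cast this)
  refine ⟨g.coeff f.natDegree / f.leadingCoeff, ?_⟩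
  set k := g.coeff f.natDegree / f.leadingCoeff with hk
  by_contra hne
  have hne' : g - Polynomial.C k * f ≠ 0 := sub_ne_zero.2 hne
  have hd := key _ hne' (by
    simp only [Polynomial.derivative_sub, Polynomial.derivative_mul, Polynomial.derivative_C]
    linear_combination h)
  have h0 : (g - Polynomial.C k * f).leadingCoeff = 0 := by
    rw [Polynomial.leadingCoeff, hd, Polynomial.coeff_sub, Polynomial.coeff_C_mul, hk]
    change _ - _ / f.leadingCoeff * f.leadingCoeff = 0
    rw [div_mul_cancel₀ _ (Polynomial.leadingCoeff_ne_zero.2 hf), sub_self]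
  exact hne' (Polynomial.leadingCoeff_eq_zero.1 h0)

/-- If the rows of the Wronskian matrix of the polynomials `f i` are linearly dependent over the
polynomial ring, then the `f i` are linearly dependent over the constants. -/
theorem exists_relation_of_wronskian_relation {ι : Type*} [DecidableEq ι]
    (f : ι → Polynomial ℂ) (n : ℕ) : ∀ (s : Finset ι), s.card = n → ∀ c : ι → Polynomial ℂ,
    (∃ i ∈ s, c i ≠ 0) →
    (∀ j < n, ∑ i ∈ s, c i * Polynomial.derivative^[j] (f i) = 0) →
    ∃ k : ι → ℂ, (∃ i ∈ s, k i ≠ 0) ∧ ∑ i ∈ s, Polynomial.C (k i) * f i = 0 := by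
  induction n with
  | zero =>
    rintro s hs c ⟨i, hi, -⟩ -
    rw [Finset.card_eq_zero] at hs
    simp [hs] at hi
  | succ n ih =>
    rintro s hs c ⟨i₀, hi₀, hc₀⟩ h
    -- `e i` is the numerator of `(c i / c i₀)'`. Dividing the relation by `c i₀` and
    -- differentiating removes the term `i₀` at the cost of one derivative. If all `e i` vanish, the
    -- ratios are constant and the given relation is already one over the constants.
    set e : ι → Polynomial ℂ := fun i =>
      c i₀ * Polynomial.derivative (c i) - Polynomial.derivative (c i₀) * c i with he
    have he₀ : e i₀ = 0 := by simp only [he]; ring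
    by_cases hall : ∀ i ∈ s, e i = 0
    · have : ∀ i ∈ s, ∃ k : ℂ, c i = Polynomial.C k * c i₀ := fun i hi =>
        exists_eq_C_mul_of_mul_derivative_eq hc₀ (sub_eq_zero.1 (hall i hi))
      choose! k hk using this
      refine ⟨k, ⟨i₀, hi₀, ?_⟩, ?_⟩
      · intro h0
        have := hk i₀ hi₀
        rw [h0] at this
        exact hc₀ (by simpa using this)
      · have h0 := h 0 (Nat.succ_pos n)
        refine (mul_eq_zero.1 ?_).resolve_left hc₀
        rw [← h0, Finset.mul_sum]
        refine Finset.sum_congr rfl fun i hi => ?_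
        conv_rhs => rw [hk i hi]
        simp only [Function.iterate_zero, id]
        ring
    · push Not at hall
      obtain ⟨i₁, hi₁, hne⟩ := hall
      have hne₁ : i₁ ≠ i₀ := by rintro rfl; exact hne he₀
      obtain ⟨k, ⟨i, hi, hki⟩, hk⟩ := ih (s.erase i₀) (by rw [Finset.card_erase_of_mem hi₀, hs]; rfl) e
        ⟨i₁, Finset.mem_erase.2 ⟨hne₁, hi₁⟩, hne⟩ (by
          intro j hj
          have h1 := h j (by omega)
          have h2 := h (j + 1) (by omega)
          have h3 := congrArg Polynomial.derivative h1
          simp only [Polynomial.derivative_sum, Polynomial.derivative_mul, map_zero,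
            Finset.sum_add_distrib, ← Function.iterate_succ_apply' Polynomial.derivative] at h3
          rw [h2, add_zero] at h3
          rw [← zero_add (∑ i ∈ s.erase i₀, _),
            ← (by rw [he₀, zero_mul] : e i₀ * Polynomial.derivative^[j] (f i₀) = 0),
            Finset.add_sum_erase s (fun i => e i * Polynomial.derivative^[j] (f i)) hi₀]
          simp only [he, sub_mul, Finset.sum_sub_distrib, mul_assoc, ← Finset.mul_sum]
          rw [h3, h1]
          ring)
      refine ⟨fun i => if i = i₀ then 0 else k i, ⟨i, Finset.mem_of_mem_erase hi, ?_⟩, ?_⟩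
      · simpa [Finset.ne_of_mem_erase hi] using hki
      · rw [← Finset.add_sum_erase s _ hi₀]
        simp only [if_true, map_zero, zero_mul, zero_add]
        rw [← hk]
        refine Finset.sum_congr rfl fun i hi => ?_
        rw [if_neg (Finset.ne_of_mem_erase hi)]

/-- The polynomial in one variable obtained by setting `t₀ = x`, `t₁ = 1`. -/
noncomputable def dehom : MvPolynomial (Fin 2) ℂ →ₐ[ℂ] Polynomial ℂ :=
  aeval ![Polynomial.X, 1]

theorem eval_dehom (F : MvPolynomial (Fin 2) ℂ) (x : ℂ) :
    (dehom F).eval x = eval ![x, 1] F := by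
  rw [dehom, ← Polynomial.coe_evalRingHom, aeval_def, hom_eval₂, eval, coe_eval₂Hom]
  congr 1
  · ext; simp
  · ext k
    fin_cases k <;> simp

theorem derivative_dehom (F : MvPolynomial (Fin 2) ℂ) :
    Polynomial.derivative (dehom F) = dehom (pderiv 0 F) := by
  induction F using MvPolynomial.induction_on with
  | C a => simp [dehom]
  | add p q hp hq => simp [hp, hq]
  | mul_X p i hp =>
    rw [map_mul, Polynomial.derivative_mul, hp, Derivation.leibniz, map_add, smul_eq_mul,
      smul_eq_mul, map_mul, map_mul, pderiv_X]
    fin_cases i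
    · simp [dehom]; ring
    · simp [dehom]

theorem iterate_derivative_dehom (F : MvPolynomial (Fin 2) ℂ) (j : ℕ) :
    Polynomial.derivative^[j] (dehom F) = dehom ((pderiv 0)^[j] F) := by
  induction j with
  | zero => rfl
  | succ j ih => rw [Function.iterate_succ_apply', ih, derivative_dehom, Function.iterate_succ_apply']

theorem eq_zero_of_dehom_eq_zero {F : MvPolynomial (Fin 2) ℂ} {n : ℕ} (hF : F.IsHomogeneous n)
    (h : dehom F = 0) : F = 0 := by
  have hX : F * X 1 = 0 := by
    refine MvPolynomial.funext fun v => ?_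
    rw [map_mul, map_zero, eval_X]
    by_cases hv : v 1 = 0
    · rw [hv, mul_zero]
    have hv' : v = v 1 • ![v 0 / v 1, 1] := by
      ext k
      fin_cases k
      · exact (mul_div_cancel₀ _ hv).symm
      · simp
    rw [hv', eval_smul_of_isHomogeneous hF, ← eval_dehom, h, Polynomial.eval_zero, mul_zero,
      zero_mul]
  exact (mul_eq_zero.1 hX).resolve_right (X_ne_zero 1)

theorem euler_dehom {F : MvPolynomial (Fin 2) ℂ} {n : ℕ} (hF : F.IsHomogeneous n) :
    Polynomial.X * dehom (pderiv 0 F) + dehom (pderiv 1 F) = Polynomial.C (n : ℂ) * dehom F := by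
  have h := congrArg dehom hF.sum_X_mul_pderiv
  simp only [Fin.sum_univ_two, map_add, map_mul, nsmul_eq_mul, map_natCast] at h
  simpa [dehom] using h

theorem pderiv_pderiv_comm (i j : Fin 2) (F : MvPolynomial (Fin 2) ℂ) :
    pderiv i (pderiv j F) = pderiv j (pderiv i F) := by
  have h : ⁅(pderiv i : Derivation ℂ (MvPolynomial (Fin 2) ℂ) (MvPolynomial (Fin 2) ℂ)),
      (pderiv j : Derivation ℂ (MvPolynomial (Fin 2) ℂ) (MvPolynomial (Fin 2) ℂ))⁆ = 0 := by
    refine MvPolynomial.derivation_ext (R := ℂ) fun l => ?_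
    rw [Derivation.commutator_apply, pderiv_X, pderiv_X]
    simp only [Pi.single_apply]
    split_ifs <;> simp
  have h' := congrArg (fun D => D F) h
  simpa [Derivation.commutator_apply, sub_eq_zero] using h'

/-- Forms of degree at least three in two variables are linearly dependent if the determinant of
their third partial derivatives vanishes. -/
theorem not_linearIndependent_of_det_eq_zero {d : ℕ} (hd : 3 ≤ d)
    {f : Fin 4 → MvPolynomial (Fin 2) ℂ} (hf : ∀ i, (f i).IsHomogeneous d)
    (h : (thirdDerivMatrix f).det = 0) : ¬ LinearIndependent ℂ f := by
  have hdet : ((thirdDerivMatrix f).map dehom).det = 0 := by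
    have := congrArg dehom h
    rwa [AlgHom.map_det, map_zero] at this
  obtain ⟨c, hc, hcM⟩ := Matrix.exists_vecMul_eq_zero_iff.2 hdet
  have hrel : ∀ j : Fin 4,
      ∑ i, c i * dehom ((pderiv 0)^[3 - (j : ℕ)] ((pderiv 1)^[(j : ℕ)] (f i))) = 0 :=
    fun j => congrFun hcM j
  -- By Euler's relation, a relation satisfied by both partial derivatives is satisfied by the forms
  -- themselves, provided their degree is nonzero. Descending from third derivatives, the same `c`
  -- annihilates all lower ones, in particular the rows of the Wronskian in `t₀`. The bound `3 ≤ d`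
  -- makes the degree `d - 2` of the second derivatives positive.
  have step : ∀ (n : ℕ) (g : Fin 4 → MvPolynomial (Fin 2) ℂ), n ≠ 0 →
      (∀ i, (g i).IsHomogeneous n) → ∑ i, c i * dehom (pderiv 0 (g i)) = 0 →
      ∑ i, c i * dehom (pderiv 1 (g i)) = 0 → ∑ i, c i * dehom (g i) = 0 := by
    intro n g hn hg h0 h1
    have hC : (Polynomial.C (n : ℂ)) ≠ 0 := by simpa using hn
    refine (mul_eq_zero.1 ?_).resolve_left hC
    rw [Finset.mul_sum]
    calc ∑ i, Polynomial.C (n : ℂ) * (c i * dehom (g i))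
        = ∑ i, (Polynomial.X * (c i * dehom (pderiv 0 (g i))) + c i * dehom (pderiv 1 (g i))) := by
          refine Finset.sum_congr rfl fun i _ => ?_
          linear_combination (-c i) * euler_dehom (hg i)
      _ = 0 := by rw [Finset.sum_add_distrib, ← Finset.mul_sum, h0, h1, mul_zero, add_zero]
  have hcomm := pderiv_pderiv_comm 1 0
  have r0 : ∑ i, c i * dehom (pderiv 0 (pderiv 0 (pderiv 0 (f i)))) = 0 := hrel 0
  have r1 : ∑ i, c i * dehom (pderiv 0 (pderiv 0 (pderiv 1 (f i)))) = 0 := hrel 1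
  have r2 : ∑ i, c i * dehom (pderiv 0 (pderiv 1 (pderiv 1 (f i)))) = 0 := hrel 2
  have r3 : ∑ i, c i * dehom (pderiv 1 (pderiv 1 (pderiv 1 (f i)))) = 0 := hrel 3
  have g1 : ∀ k i, (pderiv k (f i)).IsHomogeneous (d - 1) := fun k i => (hf i).pderiv
  have g2 : ∀ k l i, (pderiv l (pderiv k (f i))).IsHomogeneous (d - 1 - 1) :=
    fun k l i => (g1 k i).pderiv
  have s00 := step (d - 1 - 1) _ (by omega) (g2 0 0) r0 (by simpa only [hcomm] using r1)
  have s01 := step (d - 1 - 1) _ (by omega) (g2 1 0) r1 (by simpa only [hcomm] using r2)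
  have s11 := step (d - 1 - 1) _ (by omega) (g2 1 1) r2 r3
  have s0 := step (d - 1) _ (by omega) (g1 0) s00 (by simpa only [hcomm] using s01)
  have s1 := step (d - 1) _ (by omega) (g1 1) s01 s11
  have s := step d _ (by omega) hf s0 s1
  obtain ⟨i, hi⟩ := Function.ne_iff.1 hc
  obtain ⟨k, ⟨i₁, -, hk₁⟩, hk⟩ := exists_relation_of_wronskian_relation (fun i => dehom (f i)) 4
    Finset.univ (by simp) c ⟨i, Finset.mem_univ _, hi⟩ (by
      intro j hj
      simp only [iterate_derivative_dehom]
      interval_cases j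
      exacts [s, s0, s00, r0])
  intro hli
  have hzero : ∑ i, k i • f i = 0 := by
    refine eq_zero_of_dehom_eq_zero (n := d)
      (IsHomogeneous.sum _ _ _ fun i _ =>
        (homogeneousSubmodule (Fin 2) ℂ d).smul_mem _ (hf i)) ?_
    rw [map_sum, ← hk]
    refine Finset.sum_congr rfl fun i _ => ?_
    rw [map_smul, Polynomial.smul_eq_C_mul]
  exact hk₁ (Fintype.linearIndependent_iff.1 hli k hzero i₁)

/-! ### Local analysis at a cuspidal pinch point -/

open Asymptotics Filter in
/-- Local coordinates `Φ` have a first coordinate `x 0` whose linear part is a nonzero linear form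
`ℓ`: along a curve `c` through `Φ 0` with `c u - c 0 = O(uⁿ)`, the coordinates are `O(uⁿ)` and
`ℓ (c u)` agrees with the first one up to `O(u²ⁿ)`. -/
theorem IsLocalCoordinates.exists_linear_form {p : PSpace 3} {Φ : (Fin 3 → ℂ) → (Fin 4 → ℂ)}
    (hΦ : IsLocalCoordinates p Φ) :
    ∃ ℓ : (Fin 4 → ℂ) →ₗ[ℂ] ℂ, ℓ ≠ 0 ∧ ∀ (c : ℂ → Fin 4 → ℂ) (n : ℕ), ContinuousAt c 0 →
      c 0 = Φ 0 → (fun u => c u - c 0) =O[𝓝 0] (fun u => u ^ n) →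
      ∃ (x : ℂ → Fin 3 → ℂ) (μ : ℂ → ℂ), Tendsto x (𝓝 0) (𝓝 0) ∧ Tendsto μ (𝓝 0) (𝓝 1) ∧
        (∀ᶠ u in 𝓝 0, c u = μ u • Φ (x u)) ∧ x =O[𝓝 0] (fun u => u ^ n) ∧
        (fun u => ℓ (c u) - x u 0) =O[𝓝 0] (fun u => u ^ (2 * n)) := by
  -- The map `(λ, x) ↦ λ Φ(x)` lifts the coordinates from projective space to `ℂ⁴`. Its differential
  -- at `(1, 0)` is injective by `nondegenerate`, so it has a local inverse.
  set Ψ : ℂ × (Fin 3 → ℂ) → (Fin 4 → ℂ) := fun q => q.1 • Φ q.2 with hΨ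
  set q₀ : ℂ × (Fin 3 → ℂ) := (1, 0) with hq₀
  have hΨ₀ : Ψ q₀ = Φ 0 := by simp [hΨ, hq₀]
  have hA : AnalyticAt ℂ Ψ q₀ := by
    refine AnalyticAt.smul analyticAt_fst ?_
    exact AnalyticAt.comp (g := Φ) (f := Prod.snd) hΦ.analytic analyticAt_snd
  obtain ⟨P, hP⟩ := hA
  have hstrict := hP.hasStrictFDerivAt
  set Ψ' := continuousMultilinearCurryFin1 ℂ (ℂ × (Fin 3 → ℂ)) (Fin 4 → ℂ) (P 1) with hΨ'
  have hΨ'_apply : ∀ q, Ψ' q = q.1 • Φ 0 + fderiv ℂ Φ 0 q.2 := by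
    have h1 : HasFDerivAt Ψ _ q₀ :=
      (hasFDerivAt_fst (𝕜 := ℂ) (p := q₀)).smul
        (HasFDerivAt.comp (g := Φ) (f := Prod.snd) q₀
          (hΦ.analytic.differentiableAt.hasFDerivAt) hasFDerivAt_snd)
    intro q
    rw [hstrict.hasFDerivAt.unique h1]
    simp [hq₀, add_comm]
  have hinj : Function.Injective Ψ' := by
    rw [injective_iff_map_eq_zero]
    intro q hq
    rw [hΨ'_apply] at hq
    obtain ⟨h1, h2⟩ := hΦ.nondegenerate _ _ hq
    exact Prod.ext h1 h2
  let e : (ℂ × (Fin 3 → ℂ)) ≃L[ℂ] (Fin 4 → ℂ) :=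
    (LinearMap.linearEquivOfInjective Ψ'.toLinearMap hinj (by simp)).toContinuousLinearEquiv
  have he : ∀ q, e q = Ψ' q := fun q => rfl
  have hee : (e : (ℂ × (Fin 3 → ℂ)) →L[ℂ] (Fin 4 → ℂ)) = Ψ' := rfl
  have hs : HasStrictFDerivAt Ψ (e : (ℂ × (Fin 3 → ℂ)) →L[ℂ] (Fin 4 → ℂ)) q₀ := by
    rw [hee]; exact hstrict
  -- The remainder after the linear term is quadratic; this is the source of the exponent `2 * n`.
  have h2 : (fun q => Ψ q - Ψ q₀ - e (q - q₀)) =O[𝓝 q₀] fun q => ‖q - q₀‖ ^ 2 := by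
    have h := hP.isBigO_sub_partialSum_pow 2
    have ht : Tendsto (fun q => q - q₀) (𝓝 q₀) (𝓝 0) := by
      simpa using tendsto_sub_nhds_zero_iff.2 (tendsto_id (x := 𝓝 q₀))
    refine (h.comp_tendsto ht).congr' (Eventually.of_forall fun q => ?_)
      (Eventually.of_forall fun q => rfl)
    simp only [Function.comp, FormalMultilinearSeries.partialSum, Finset.sum_range_succ,
      Finset.sum_range_zero, zero_add, he, hΨ', add_sub_cancel]
    have h0 : (P 0) (fun _ => q - q₀) = Ψ q₀ := hP.coeff_zero _
    rw [h0, sub_sub]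
    congr 2
  -- The linear form is the `x 0`-component of the inverse differential.
  let L : (Fin 4 → ℂ) →L[ℂ] ℂ := (ContinuousLinearMap.proj 0).comp
    ((ContinuousLinearMap.snd ℂ ℂ (Fin 3 → ℂ)).comp
      (e.symm : (Fin 4 → ℂ) →L[ℂ] (ℂ × (Fin 3 → ℂ))))
  have hL : ∀ v, L v = (e.symm v).2 0 := fun v => rfl
  refine ⟨L.toLinearMap, ?_, ?_⟩
  · intro h
    have h' := LinearMap.congr_fun h (e (0, Pi.single 0 1))
    simp [hL] at h'
  intro c n hc hc0 hcO
  have hc' : Tendsto c (𝓝 0) (𝓝 (Ψ q₀)) := by rw [hΨ₀, ← hc0]; exact hc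
  set w : ℂ → ℂ × (Fin 3 → ℂ) := fun u => hs.localInverse Ψ e q₀ (c u) with hw
  have hw0 : w 0 = q₀ := by
    simp only [hw, hc0, ← hΨ₀]
    exact hs.localInverse_apply_image
  have hwt : Tendsto w (𝓝 0) (𝓝 q₀) := hs.localInverse_tendsto.comp hc'
  have hright : ∀ᶠ u in 𝓝 0, Ψ (w u) = c u := hc'.eventually hs.eventually_right_inverse
  have hwO : (fun u => w u - q₀) =O[𝓝 0] (fun u => u ^ n) := by
    have h := (hs.to_localInverse.hasFDerivAt.isBigO_sub).comp_tendsto hc'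
    refine IsBigO.trans (h.congr_left fun u => ?_) (hcO.congr_left fun u => ?_)
    · simp only [Function.comp, hs.localInverse_apply_image, hw]
    · simp only [Function.comp, hc0, hΨ₀]
  refine ⟨fun u => (w u).2, fun u => (w u).1, ?_, ?_, ?_, ?_, ?_⟩
  · exact (continuous_snd.tendsto q₀).comp hwt
  · exact (continuous_fst.tendsto q₀).comp hwt
  · filter_upwards [hright] with u hu
    exact hu.symm
  · refine IsBigO.trans (IsBigO.of_bound 1 (Eventually.of_forall fun u => ?_)) hwO
    rw [one_mul]
    have := norm_snd_le (w u - q₀)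
    simpa [hq₀] using this
  · have h3 := h2.comp_tendsto hwt
    have h4 : (fun u => c u - c 0 - e (w u - q₀)) =O[𝓝 0] (fun u => u ^ (2 * n)) := by
      refine IsBigO.trans (h3.congr' ?_ EventuallyEq.rfl) ?_
      · filter_upwards [hright] with u hu
        simp only [Function.comp, hu, hΨ₀, hc0]
      · refine (hwO.norm_left.pow 2).congr_right fun u => ?_
        ring
    refine IsBigO.trans (IsBigO.congr_left (L.isBigO_comp _ _) fun u => ?_) h4
    have e1 : e.symm (c 0) = q₀ := by
      rw [ContinuousLinearEquiv.symm_apply_eq, he, hΨ'_apply, hc0]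
      simp [hq₀]
    simp [hL, e1, hq₀]

/-! ### Orders of vanishing along a line -/

open Asymptotics Filter in
theorem X_pow_dvd_of_isBigO {P : Polynomial ℂ} {n : ℕ}
    (h : (fun u => P.eval u) =O[𝓝 0] (fun u => u ^ n)) : Polynomial.X ^ n ∣ P := by
  induction n with
  | zero => simp
  | succ n ih =>
    have hle : (fun u : ℂ => u ^ (n + 1)) =O[𝓝 0] (fun u => u ^ n) := by
      have : Tendsto (fun u : ℂ => u) (𝓝 0) (𝓝 0) := tendsto_id
      simpa [pow_succ] using (isBigO_refl (fun u : ℂ => u ^ n) (𝓝 0)).mul (this.isBigO_one ℂ)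
    obtain ⟨Q, rfl⟩ := ih (h.trans hle)
    have hQ : (fun u => Q.eval u) =O[𝓝[≠] 0] (fun u : ℂ => u) := by
      obtain ⟨C, hC⟩ := h.bound
      refine IsBigO.of_bound C ?_
      filter_upwards [hC.filter_mono nhdsWithin_le_nhds, self_mem_nhdsWithin] with u hu hu0
      have hpos : 0 < ‖u‖ ^ n := pow_pos (norm_pos_iff.2 hu0) n
      rw [Polynomial.eval_mul, Polynomial.eval_pow, Polynomial.eval_X, norm_mul, norm_pow,
        norm_pow, pow_succ] at hu
      refine le_of_mul_le_mul_left ?_ hpos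
      linarith
    have h0 : Tendsto (fun u => Q.eval u) (𝓝[≠] 0) (𝓝 0) :=
      hQ.trans_tendsto (tendsto_id.mono_left nhdsWithin_le_nhds)
    have h1 : Tendsto (fun u => Q.eval u) (𝓝[≠] 0) (𝓝 (Q.eval 0)) :=
      (Q.continuous.tendsto 0).mono_left nhdsWithin_le_nhds
    have hX : Polynomial.X ∣ Q := by
      rw [Polynomial.X_dvd_iff, Polynomial.coeff_zero_eq_eval_zero]
      exact tendsto_nhds_unique h1 h0
    rw [pow_succ]
    exact mul_dvd_mul_left _ hX

open Asymptotics Filter in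
theorem isBigO_of_X_pow_dvd {P : Polynomial ℂ} {n : ℕ} (h : Polynomial.X ^ n ∣ P) :
    (fun u => P.eval u) =O[𝓝 0] (fun u => u ^ n) := by
  obtain ⟨Q, rfl⟩ := h
  have hQ : (fun u => Q.eval u) =O[𝓝 0] (fun _ => (1 : ℂ)) :=
    (Q.continuous.tendsto 0).isBigO_one ℂ
  simpa using (isBigO_refl (fun u : ℂ => u ^ n) (𝓝 0)).mul hQ

/-- The restriction of a polynomial to the line `τ - s e_k`. -/
noncomputable def restrictLine (τ : Fin 2 → ℂ) (k : Fin 2) :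
    MvPolynomial (Fin 2) ℂ →ₐ[ℂ] Polynomial ℂ :=
  aeval fun i => Polynomial.C (τ i) - if i = k then Polynomial.X else 0

theorem eval_restrictLine (τ : Fin 2 → ℂ) (k : Fin 2) (F : MvPolynomial (Fin 2) ℂ) (s : ℂ) :
    (restrictLine τ k F).eval s = eval (τ - Pi.single k s) F := by
  rw [restrictLine, ← Polynomial.coe_evalRingHom, aeval_def, hom_eval₂, eval, coe_eval₂Hom]
  congr 1
  · ext; simp
  · ext i
    by_cases h : i = k
    · subst h; simp
    · simp [h]

theorem derivative_restrictLine (τ : Fin 2 → ℂ) (k : Fin 2) (F : MvPolynomial (Fin 2) ℂ) :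
    Polynomial.derivative (restrictLine τ k F) = -restrictLine τ k (pderiv k F) := by
  induction F using MvPolynomial.induction_on with
  | C a => simp [restrictLine]
  | add p q hp hq => rw [map_add, map_add, hp, hq, map_add, map_add, neg_add]
  | mul_X p i hp =>
    rw [map_mul, Polynomial.derivative_mul, hp, Derivation.leibniz, map_add, smul_eq_mul,
      smul_eq_mul, map_mul, map_mul, pderiv_X]
    have hX : restrictLine τ k (X i) = Polynomial.C (τ i) - if i = k then Polynomial.X else 0 := by
      simp [restrictLine]
    rw [hX]
    by_cases h : i = k
    · subst h
      simp
      ring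
    · rw [Pi.single_apply, if_neg h, if_neg h]
      simp
      ring

theorem eval_iterate_pderiv_eq_zero {τ : Fin 2 → ℂ} {k : Fin 2} {F : MvPolynomial (Fin 2) ℂ}
    {n : ℕ} (h : Polynomial.X ^ n ∣ restrictLine τ k F) {m : ℕ} (hm : m < n) :
    eval τ ((pderiv k)^[m] F) = 0 := by
  have key : ∀ m, Polynomial.derivative^[m] (restrictLine τ k F) =
      (-1) ^ m * restrictLine τ k ((pderiv k)^[m] F) := by
    intro m
    induction m with
    | zero => simp
    | succ m ih =>
      rw [Function.iterate_succ_apply', ih, Function.iterate_succ_apply', Polynomial.derivative_mul,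
        derivative_restrictLine]
      have : Polynomial.derivative ((-1 : Polynomial ℂ) ^ m) = 0 := by
        rw [Polynomial.derivative_pow]; simp
      rw [this]
      ring
  have h1 := Polynomial.pow_sub_dvd_iterate_derivative_of_pow_dvd m h
  have h2 : Polynomial.X ∣ Polynomial.derivative^[m] (restrictLine τ k F) :=
    (dvd_pow_self _ (by omega)).trans h1
  rw [Polynomial.X_dvd_iff, Polynomial.coeff_zero_eq_eval_zero, key, Polynomial.eval_mul,
    eval_restrictLine] at h2
  simpa using h2

/-- If a binary form vanishes to order four at a point, then its third derivatives vanish. -/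
theorem eval_pderiv_pderiv_pderiv_eq_zero {d : ℕ} {F : MvPolynomial (Fin 2) ℂ}
    (hF : F.IsHomogeneous d) {τ : Fin 2 → ℂ} {k k' : Fin 2} (hk : k ≠ k') (hτ : τ k' ≠ 0)
    (h : ∀ m < 4, eval τ ((pderiv k)^[m] F) = 0) (a b c : Fin 2) :
    eval τ (pderiv a (pderiv b (pderiv c F))) = 0 := by
  -- Where `τ k' ≠ 0`, Euler's relation determines `∂_{k'} G` from `G` and `∂_k G`.
  have step : ∀ (n : ℕ) (G : MvPolynomial (Fin 2) ℂ), G.IsHomogeneous n → eval τ G = 0 →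
      eval τ (pderiv k G) = 0 → ∀ a, eval τ (pderiv a G) = 0 := by
    intro n G hG h0 h1 a
    by_cases ha : a = k
    · rw [ha, h1]
    have e := euler_eval hG τ
    refine (mul_eq_zero.1 ?_).resolve_left hτ
    fin_cases k <;> fin_cases k' <;> fin_cases a <;> simp_all
  have f0 : eval τ F = 0 := h 0 (by norm_num)
  have f1 : eval τ (pderiv k F) = 0 := h 1 (by norm_num)
  have f2 : eval τ (pderiv k (pderiv k F)) = 0 := h 2 (by norm_num)
  have f3 : eval τ (pderiv k (pderiv k (pderiv k F))) = 0 := h 3 (by norm_num)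
  have p1 : ∀ a, eval τ (pderiv a F) = 0 := step d F hF f0 f1
  have p2k : ∀ a, eval τ (pderiv a (pderiv k F)) = 0 := step _ _ hF.pderiv f1 f2
  have p2 : ∀ b a, eval τ (pderiv b (pderiv a F)) = 0 := fun b a =>
    step _ _ hF.pderiv (p1 a) (by rw [pderiv_pderiv_comm, p2k]) b
  have p3kk : ∀ a, eval τ (pderiv a (pderiv k (pderiv k F))) = 0 :=
    step _ _ hF.pderiv.pderiv f2 f3
  have p3k : ∀ a b, eval τ (pderiv a (pderiv b (pderiv k F))) = 0 := fun a b =>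
    step _ _ hF.pderiv.pderiv (p2 b k) (by rw [pderiv_pderiv_comm, p3kk]) a
  exact step _ _ hF.pderiv.pderiv (p2 b c)
    (by rw [pderiv_pderiv_comm, pderiv_pderiv_comm k c, p3k]) a

theorem evalAt_mem_curve {n : ℕ} {f : Fin (n + 1) → MvPolynomial (Fin 2) ℂ} {τ : Fin 2 → ℂ}
    (hτ : τ ≠ 0) {p : PSpace n} (h : Represents (evalAt f τ) p) : p ∈ curve f :=
  ⟨τ, hτ, h⟩

/-- Euler's relation writes the point of the curve as a combination of the two partial derivatives
with coefficients `τ 0 / d` and `τ 1 / d`. -/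
theorem mem_tangentDevelopable {d n : ℕ} (hd : d ≠ 0) {f : Fin (n + 1) → MvPolynomial (Fin 2) ℂ}
    (hf : ∀ i, (f i).IsHomogeneous d) {τ : Fin 2 → ℂ} (hτ : τ ≠ 0) {p : PSpace n} (k : Fin 2)
    (a b : ℂ) (h : Represents (a • evalAt f τ + b • partialAt f k τ) p) :
    p ∈ tangentDevelopable f := by
  have hd' : (d : ℂ) ≠ 0 := by exact_mod_cast hd
  have e : ∀ i, evalAt f τ i = (τ 0 / d) * partialAt f 0 τ i + (τ 1 / d) * partialAt f 1 τ i := by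
    intro i
    have := euler_eval (hf i) τ
    simp only [evalAt, partialAt]
    field_simp
    linear_combination -this
  refine ⟨τ, hτ, a * (τ 0 / d) + if k = 0 then b else 0, a * (τ 1 / d) + if k = 1 then b else 0, ?_⟩
  convert h using 1
  ext i
  simp only [Pi.add_apply, Pi.smul_apply, smul_eq_mul, e]
  fin_cases k
  · simp; ring
  · simp; ring

open Asymptotics Filter in
/-- At a point of the curve `f` where the tangent developable has the local equation
`z² y³ - x² = 0` and the curve is given by `x = y = 0`, the determinant of the third partial
derivatives vanishes. -/
theorem det_eq_zero_of_pinch {d : ℕ} (hd : d ≠ 0) {f : Fin 4 → MvPolynomial (Fin 2) ℂ}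
    (hf : ∀ i, (f i).IsHomogeneous d) {τ : Fin 2 → ℂ} (hτ : τ ≠ 0) {p : PSpace 3}
    (hp : Represents (n := 3) (evalAt f τ) p) {Φ : (Fin 3 → ℂ) → (Fin 4 → ℂ)}
    (hΦ : IsLocalCoordinates p Φ)
    (hS : HasLocalForm Φ (tangentDevelopable (n := 3) f) {x | x 2 ^ 2 * x 1 ^ 3 - x 0 ^ 2 = 0})
    (hC : HasLocalForm Φ (curve (n := 3) f) {x | x 0 = 0 ∧ x 1 = 0}) :
    eval τ (thirdDerivMatrix f).det = 0 := by
  -- The nonzero coordinate `k'` stays fixed on the line `τ - u e_k`, which therefore avoids the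
  -- origin.
  obtain ⟨k, k', hk, hτk⟩ : ∃ k k' : Fin 2, k ≠ k' ∧ τ k' ≠ 0 := by
    obtain ⟨i, hi⟩ := Function.ne_iff.1 hτ
    fin_cases i
    · exact ⟨1, 0, by simp, hi⟩
    · exact ⟨0, 1, by simp, hi⟩
  have hne : ∀ u, τ - Pi.single k u ≠ 0 := by
    intro u h
    have := congrFun h k'
    simp [hk.symm] at this
    exact hτk this
  obtain ⟨κ, hκ, hκΦ⟩ := hp.exists_smul hΦ.center
  obtain ⟨ℓ, hℓ, H⟩ := hΦ.exists_linear_form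
  set F : MvPolynomial (Fin 2) ℂ := ∑ i, ℓ (Pi.single i 1) • f i with hF
  have hℓv : ∀ v, ℓ v = ∑ i, ℓ (Pi.single i 1) * v i := by
    intro v
    conv_lhs => rw [LinearMap.pi_apply_eq_sum_univ ℓ v]
    refine Finset.sum_congr rfl fun i _ => ?_
    rw [smul_eq_mul, mul_comm]
    congr 2
    ext j
    simp [Pi.single_apply, eq_comm]
  have hFhom : F.IsHomogeneous d := IsHomogeneous.sum _ _ _ fun i _ =>
    (homogeneousSubmodule (Fin 2) ℂ d).smul_mem _ (hf i)
  have hFev : ∀ v, ℓ (evalAt (n := 3) f v) = eval v F := by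
    intro v
    rw [hℓv, hF, map_sum]
    simp only [smul_eval]
    rfl
  have hFev' : ∀ v, ℓ (partialAt (n := 3) f k v) = eval v (pderiv k F) := by
    intro v
    rw [hℓv, hF, map_sum, map_sum]
    refine Finset.sum_congr rfl fun i _ => ?_
    rw [Derivation.map_smul, smul_eval]
    rfl
  set φ := restrictLine τ k F with hφ
  have polyvec : ∀ (c : ℂ → Fin 4 → ℂ) (n : ℕ) (P : Fin 4 → Polynomial ℂ),
      (∀ u i, c u i = (P i).eval u) → (∀ i, Polynomial.X ^ n ∣ P i - Polynomial.C ((P i).eval 0)) →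
      ContinuousAt c 0 ∧ (fun u => c u - c 0) =O[𝓝 0] (fun u => u ^ n) := by
    intro c n P hc hP
    constructor
    · rw [continuousAt_pi]
      intro i
      simp only [hc]
      exact (P i).continuous.continuousAt
    · rw [isBigO_pi]
      intro i
      refine (isBigO_of_X_pow_dvd (hP i)).congr_left fun u => ?_
      simp [hc]
  -- the curve itself
  have hφ2 : Polynomial.X ^ 2 ∣ φ := by
    obtain ⟨h1, h2⟩ := polyvec (fun u => κ • evalAt (n := 3) f (τ - Pi.single k u)) 1
      (fun i => Polynomial.C κ * restrictLine τ k (f i))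
      (by intro u i; simp [evalAt, eval_restrictLine])
      (by intro i; rw [pow_one, Polynomial.X_dvd_iff]; simp [Polynomial.coeff_zero_eq_eval_zero])
    -- On the curve the coordinate `x 0` is zero, so `ℓ` itself is `O(u²)`.
    obtain ⟨x, μ, hx, hμ, hc, -, hO⟩ := H _ 1 h1 (by simp [hκΦ]) h2
    have hx0 : ∀ᶠ u in 𝓝 0, x u 0 = 0 := by
      filter_upwards [hx.eventually hC, hc, hμ.eventually_ne one_ne_zero,
        h1.eventually_ne (y := 0) (by simpa [← hκΦ] using hΦ.center.ne_zero)] with u h1 h2 h3 h4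
      refine (h1.1 ⟨Projectivization.mk ℂ _ h4, ?_, ?_⟩).1
      · exact evalAt_mem_curve (hne u) (by
          simpa [smul_smul, hκ] using (represents_mk h4).smul (inv_ne_zero hκ))
      · have := (represents_mk h4).smul (inv_ne_zero h3)
        conv at this => enter [1]; rw [h2]
        rwa [inv_smul_smul₀ h3] at this
    have : (fun u => κ * φ.eval u) =O[𝓝 0] (fun u => u ^ 2) := by
      refine hO.congr' ?_ EventuallyEq.rfl
      filter_upwards [hx0] with u hu
      rw [hu, map_smul, hFev, hφ, eval_restrictLine, sub_zero, smul_eq_mul]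
    exact X_pow_dvd_of_isBigO ((isBigO_const_mul_left_iff hκ).1 this)
  -- a curve on the tangent developable
  have hφ4 : Polynomial.X ^ 4 ∣ φ - Polynomial.X * Polynomial.derivative φ := by
    obtain ⟨h1, h2⟩ := polyvec (fun u => κ • (evalAt (n := 3) f (τ - Pi.single k u) +
        u • partialAt (n := 3) f k (τ - Pi.single k u))) 2
      (fun i => Polynomial.C κ * (restrictLine τ k (f i) -
        Polynomial.X * Polynomial.derivative (restrictLine τ k (f i))))
      (by intro u i; simp [evalAt, partialAt, eval_restrictLine, derivative_restrictLine])
      (by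
        intro i
        rw [Polynomial.X_pow_dvd_iff]
        intro m hm
        interval_cases m
        · simp [Polynomial.coeff_zero_eq_eval_zero]
        · simp [Polynomial.coeff_derivative])
    -- In `f + u ∂_k f` at `τ - u e_k` the terms linear in `u` cancel. Hence all three coordinates
    -- are `O(u²)`, and `ℓ` agrees with `x 0` up to `O(u⁴)`.
    obtain ⟨x, μ, hx, hμ, hc, hxO, hO⟩ := H _ 2 h1 (by simp [hκΦ]) h2
    have hxeq : ∀ᶠ u in 𝓝 0, x u 2 ^ 2 * x u 1 ^ 3 - x u 0 ^ 2 = 0 := by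
      filter_upwards [hx.eventually hS, hc, hμ.eventually_ne one_ne_zero,
        h1.eventually_ne (y := 0) (by simpa [← hκΦ] using hΦ.center.ne_zero)] with u h1 h2 h3 h4
      refine h1.1 ⟨Projectivization.mk ℂ _ h4, ?_, ?_⟩
      · refine mem_tangentDevelopable (n := 3) hd hf (hne u) k 1 u ?_
        rw [one_smul]
        simpa only [inv_smul_smul₀ hκ] using (represents_mk h4).smul (inv_ne_zero hκ)
      · have := (represents_mk h4).smul (inv_ne_zero h3)
        conv at this => enter [1]; rw [h2]
        rwa [inv_smul_smul₀ h3] at this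
    have hxi := isBigO_pi.1 hxO
    -- `x² = z²y³` is `O(u⁴ · u⁶)`, so `x` is `O(u⁵)`, which is below the error `O(u⁴)`.
    have hx5 : (fun u => x u 0) =O[𝓝 0] (fun u : ℂ => u ^ 5) := by
      refine IsBigO.of_pow two_ne_zero ?_
      refine (((hxi 2).pow 2).mul ((hxi 1).pow 3)).congr' ?_ ?_
      · filter_upwards [hxeq] with u hu
        simp only [Pi.pow_apply]
        linear_combination hu
      · exact Eventually.of_forall fun u => by simp only [Pi.pow_apply]; ring
    have hx4 : (fun u => x u 0) =O[𝓝 0] (fun u : ℂ => u ^ 4) := by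
      have : Tendsto (fun u : ℂ => u) (𝓝 0) (𝓝 0) := tendsto_id
      have h := (isBigO_refl (fun u : ℂ => u ^ 4) (𝓝 0)).mul (this.isBigO_one ℂ)
      simp only [mul_one, ← pow_succ] at h
      exact hx5.trans h
    have : (fun u => κ * (φ - Polynomial.X * Polynomial.derivative φ).eval u) =O[𝓝 0]
        (fun u => u ^ 4) := by
      refine (hO.add hx4).congr_left fun u => ?_
      rw [map_smul, map_add, map_smul, hFev, hFev', hφ, derivative_restrictLine]
      simp [eval_restrictLine]
    exact X_pow_dvd_of_isBigO ((isBigO_const_mul_left_iff hκ).1 this)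
  -- The coefficient of `u^m` in `φ - u φ'` is `(1 - m)` times that of `φ`. This loses only `m = 1`,
  -- which `hφ2` supplies.
  have hφ' : Polynomial.X ^ 4 ∣ φ := by
    rw [Polynomial.X_pow_dvd_iff] at hφ2 hφ4 ⊢
    intro m hm
    have h2 := hφ2 m
    have h4 := hφ4 m hm
    interval_cases m
    · exact h2 (by norm_num)
    · exact h2 (by norm_num)
    · simp [Polynomial.coeff_derivative] at h4
      linear_combination -h4
    · simp [Polynomial.coeff_derivative] at h4
      linear_combination (-1 / 2 : ℂ) * h4
  have hthird := eval_pderiv_pderiv_pderiv_eq_zero hFhom hk hτk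
    (fun m hm => eval_iterate_pderiv_eq_zero hφ' hm)
  rw [RingHom.map_det]
  -- The coefficients of `ℓ` form a nonzero left kernel vector, since the third derivatives of `ℓ ∘
  -- f` vanish at `τ`.
  refine Matrix.exists_vecMul_eq_zero_iff.1 ⟨fun i => ℓ (Pi.single i 1), ?_, ?_⟩
  · intro h
    apply hℓ
    ext i
    simpa using congrFun h i
  · ext j
    have e : ∀ a b c, ∑ i, ℓ (Pi.single i 1) * eval τ (pderiv a (pderiv b (pderiv c (f i)))) = 0 := by
      intro a b c
      rw [← hthird a b c, hF]
      simp only [map_sum, Derivation.map_smul, smul_eval]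
    fin_cases j
    · exact e 0 0 0
    · exact e 0 0 1
    · exact e 0 1 1
    · exact e 1 1 1

/-! ### Common roots of a family of polynomials with polynomial coefficients -/

theorem eventually_eval_ne_zero {P : Polynomial ℂ} (hP : P ≠ 0) :
    ∀ᶠ s in Filter.cofinite, P.eval s ≠ 0 := by
  rw [Filter.eventually_cofinite]
  refine (P.roots.toFinset.finite_toSet).subset fun s hs => ?_
  simpa [hP] using hs

theorem eq_zero_of_eventually_eval_eq_zero {P : Polynomial ℂ}
    (h : ∀ᶠ s in Filter.cofinite, P.eval s = 0) : P = 0 := by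
  by_contra hP
  obtain ⟨s, h1, h2⟩ := ((eventually_eval_ne_zero hP).and h).exists
  exact h1 h2

/-- An ideal of polynomials over a domain is principal up to nonzero constants. -/
theorem exists_mem_dvd_C_mul {D : Type*} [CommRing D] [IsDomain D] (I : Ideal (Polynomial D))
    (hI : I ≠ ⊥) : ∃ Q ∈ I, Q ≠ 0 ∧ ∀ P ∈ I, ∃ δ : D, δ ≠ 0 ∧ Q ∣ Polynomial.C δ * P := by
  classical
  have hex : ∃ n, ∃ Q ∈ I, Q ≠ 0 ∧ Q.natDegree = n := by
    obtain ⟨Q, hQ, hQ0⟩ := Submodule.exists_mem_ne_zero_of_ne_bot hI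
    exact ⟨_, Q, hQ, hQ0, rfl⟩
  obtain ⟨Q, hQ, hQ0, hQn⟩ := Nat.find_spec hex
  have hmin : ∀ P ∈ I, P ≠ 0 → Q.natDegree ≤ P.natDegree := by
    intro P hP hP0
    rw [hQn]
    exact Nat.find_min' hex ⟨P, hP, hP0, rfl⟩
  have hlc : Q.leadingCoeff ≠ 0 := Polynomial.leadingCoeff_ne_zero.2 hQ0
  refine ⟨Q, hQ, hQ0, ?_⟩
  -- Pseudo-division by an element of least degree: cancelling leading terms lowers the degree of
  -- `P`, after multiplication by the leading coefficient of `Q`.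
  suffices h : ∀ n, ∀ P ∈ I, P.natDegree ≤ n → ∃ δ : D, δ ≠ 0 ∧ Q ∣ Polynomial.C δ * P from
    fun P hP => h _ P hP le_rfl
  have hconst : Q.natDegree = 0 → ∀ P, ∃ δ : D, δ ≠ 0 ∧ Q ∣ Polynomial.C δ * P := by
    intro h0 P
    obtain ⟨a, rfl⟩ := Polynomial.natDegree_eq_zero.1 h0
    exact ⟨a, fun h => hQ0 (by rw [h, map_zero]), dvd_mul_right _ _⟩
  intro n
  induction n with
  | zero =>
    intro P hP hn
    by_cases hP0 : P = 0
    · exact ⟨1, one_ne_zero, by simp [hP0]⟩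
    exact hconst (by have := hmin P hP hP0; omega) P
  | succ n ih =>
    intro P hP hn
    by_cases hP0 : P = 0
    · exact ⟨1, one_ne_zero, by simp [hP0]⟩
    by_cases h0 : P.natDegree = 0
    · exact hconst (by have := hmin P hP hP0; omega) P
    have hle := hmin P hP hP0
    have hlt := Polynomial.natDegree_cancelLeads_lt_of_natDegree_le_natDegree hle
      (Nat.pos_of_ne_zero h0)
    have hmem : Q.cancelLeads P ∈ I :=
      I.sub_mem (I.mul_mem_left _ hP) (I.mul_mem_left _ hQ)
    obtain ⟨δ, hδ, hdvd⟩ := ih _ hmem (by omega)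
    refine ⟨δ * Q.leadingCoeff, mul_ne_zero hδ hlc, ?_⟩
    rw [Polynomial.cancelLeads, Nat.sub_eq_zero_of_le hle, pow_zero, mul_one, mul_sub] at hdvd
    have h2 := (dvd_sub_left (dvd_mul_of_dvd_right (dvd_mul_left Q
      (Polynomial.C P.leadingCoeff * Polynomial.X ^ (P.natDegree - Q.natDegree)))
        (Polynomial.C δ))).1 hdvd
    rwa [← mul_assoc, ← map_mul] at h2

/-- If a finite family of polynomials in `t` with coefficients in `ℂ[s]` has, for almost all `s`,
exactly one common root `t`, then this root is a rational function of `s`. -/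
theorem exists_rational_root {ι : Type*} [Finite ι] (P : ι → Polynomial (Polynomial ℂ))
    (h : ∀ᶠ s in Filter.cofinite, ∃! t : ℂ, ∀ j, ((P j).map (Polynomial.evalRingHom s)).eval t = 0) :
    ∃ p q : Polynomial ℂ, q ≠ 0 ∧ IsCoprime p q ∧ ∀ᶠ s in Filter.cofinite, q.eval s ≠ 0 ∧
      ∀ j, ((P j).map (Polynomial.evalRingHom s)).eval (p.eval s / q.eval s) = 0 := by
  suffices hs : ∃ p q : Polynomial ℂ, q ≠ 0 ∧ ∀ᶠ s in Filter.cofinite, q.eval s ≠ 0 ∧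
      ∀ j, ((P j).map (Polynomial.evalRingHom s)).eval (p.eval s / q.eval s) = 0 by
    obtain ⟨p, q, hq, hpq⟩ := hs
    obtain ⟨g, p', q', hcop, hp', hq'⟩ : ∃ g p' q' : Polynomial ℂ, IsCoprime p' q' ∧
        p = p' * g ∧ q = q' * g := by
      have hg := gcd_ne_zero_of_right (a := p) hq
      exact ⟨GCDMonoid.gcd p q, p / GCDMonoid.gcd p q, q / GCDMonoid.gcd p q,
        isCoprime_div_gcd_div_gcd hq,
        by rw [mul_comm, EuclideanDomain.mul_div_cancel' hg (gcd_dvd_left p q)],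
        by rw [mul_comm, EuclideanDomain.mul_div_cancel' hg (gcd_dvd_right p q)]⟩
    subst hp' hq'
    refine ⟨p', q', left_ne_zero_of_mul hq, hcop, ?_⟩
    filter_upwards [hpq] with s hs
    rw [Polynomial.eval_mul, Polynomial.eval_mul] at hs
    have hg := right_ne_zero_of_mul hs.1
    refine ⟨left_ne_zero_of_mul hs.1, ?_⟩
    rw [← mul_div_mul_right _ _ hg]
    exact hs.2
  set I : Ideal (Polynomial (Polynomial ℂ)) := Ideal.span (Set.range P) with hI
  have hPI : ∀ j, P j ∈ I := fun j => Ideal.subset_span ⟨j, rfl⟩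
  have hIbot : I ≠ ⊥ := by
    intro hbot
    obtain ⟨s, t, -, ht⟩ := h.exists
    have h0 : ∀ j, P j = 0 := fun j => by
      have := hPI j
      rwa [hbot, Ideal.mem_bot] at this
    have e1 := ht 0 (fun j => by simp [h0 j])
    have e2 := ht 1 (fun j => by simp [h0 j])
    exact zero_ne_one (e1.trans e2.symm)
  obtain ⟨Q, hQ, hQ0, hdvd⟩ := exists_mem_dvd_C_mul I hIbot
  choose δ hδ hδdvd using fun j => hdvd (P j) (hPI j)
  have hlc : Q.leadingCoeff ≠ 0 := Polynomial.leadingCoeff_ne_zero.2 hQ0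
  -- For almost all `s` the common root is the only root of `Q(s, ·)`: a root of `Q` is a root of
  -- every `P j` because `δ j` does not vanish at `s`, and conversely `Q` lies in the ideal.
  have hgood : ∀ᶠ s in Filter.cofinite, Q.leadingCoeff.eval s ≠ 0 ∧
      ∃ t : ℂ, (∀ j, ((P j).map (Polynomial.evalRingHom s)).eval t = 0) ∧
        ∀ t', (Q.map (Polynomial.evalRingHom s)).eval t' = 0 ↔ t' = t := by
    filter_upwards [h, eventually_eval_ne_zero hlc,
      Filter.eventually_all.2 fun j => eventually_eval_ne_zero (hδ j)] with s hs h1 h2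
    obtain ⟨t, ht, htu⟩ := hs
    refine ⟨h1, t, ht, fun t' => ⟨fun ht' => htu t' fun j => ?_, ?_⟩⟩
    · obtain ⟨R, hR⟩ := hδdvd j
      have := congrArg (fun F => (F.map (Polynomial.evalRingHom s)).eval t') hR
      simp only [Polynomial.map_mul, Polynomial.map_C, Polynomial.eval_mul, Polynomial.eval_C, ht',
        zero_mul, Polynomial.coe_evalRingHom] at this
      exact (mul_eq_zero.1 this).resolve_left (h2 j)
    · rintro rfl
      have hle : I ≤ RingHom.ker ((Polynomial.evalRingHom t').comp
          (Polynomial.mapRingHom (Polynomial.evalRingHom s))) := by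
        rw [hI, Ideal.span_le]
        rintro _ ⟨j, rfl⟩
        simpa [RingHom.mem_ker] using ht j
      simpa [RingHom.mem_ker] using hle hQ
  have hdeg : 0 < Q.natDegree := by
    by_contra hle
    obtain ⟨s, h1, t, -, h2⟩ := hgood.exists
    obtain ⟨a, rfl⟩ := Polynomial.natDegree_eq_zero.1 (by omega : Q.natDegree = 0)
    have := (h2 t).2 rfl
    simp at this h1
    exact h1 this
  -- With `n` the degree of `Q`, its specialization at `s` is a constant times `(T - t)^n`, so `t`
  -- can be read off its two highest coefficients.
  refine ⟨-Q.coeff (Q.natDegree - 1), Polynomial.C (Q.natDegree : ℂ) * Q.leadingCoeff,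
    mul_ne_zero (by simpa using hdeg.ne') hlc, ?_⟩
  filter_upwards [hgood] with s hs
  obtain ⟨h1, t, ht, htQ⟩ := hs
  set q := Q.map (Polynomial.evalRingHom s) with hq
  have hqdeg : q.natDegree = Q.natDegree :=
    Polynomial.natDegree_map_of_leadingCoeff_ne_zero _ h1
  have hqlc : q.leadingCoeff = Q.leadingCoeff.eval s :=
    Polynomial.leadingCoeff_map_of_leadingCoeff_ne_zero _ h1
  have hsplit : q.Splits := IsAlgClosed.splits q
  have hroots : q.roots = Multiset.replicate Q.natDegree t := by
    rw [Multiset.eq_replicate]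
    refine ⟨by rw [← hqdeg]; exact hsplit.natDegree_eq_card_roots.symm, fun b hb => ?_⟩
    exact (htQ b).1 (Polynomial.isRoot_of_mem_roots hb)
  have hn0 : (Q.natDegree : ℂ) ≠ 0 := by exact_mod_cast hdeg.ne'
  have hnext := hsplit.nextCoeff_eq_neg_sum_roots_mul_leadingCoeff
  rw [Polynomial.nextCoeff_of_natDegree_pos (by omega), hqdeg, hqlc, hroots,
    Multiset.sum_replicate, hq, Polynomial.coeff_map, nsmul_eq_mul] at hnext
  have hval : (-Q.coeff (Q.natDegree - 1)).eval s /
      (Polynomial.C (Q.natDegree : ℂ) * Q.leadingCoeff).eval s = t := by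
    rw [Polynomial.eval_mul, Polynomial.eval_C, div_eq_iff (mul_ne_zero hn0 h1), Polynomial.eval_neg]
    rw [Polynomial.coe_evalRingHom] at hnext
    rw [hnext]
    ring
  refine ⟨by rw [Polynomial.eval_mul, Polynomial.eval_C]; exact mul_ne_zero hn0 h1, ?_⟩
  rw [hval]
  exact ht

/-- Two proportional tuples of polynomials without common roots agree up to a constant. -/
theorem exists_eq_C_mul_of_no_common_root {ι : Type*} [Finite ι] (a b : ι → Polynomial ℂ)
    (ha : ∀ s, ∃ i, (a i).eval s ≠ 0) (hb : ∀ s, ∃ i, (b i).eval s ≠ 0)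
    (h : ∀ i j, a i * b j = a j * b i) : ∃ c : ℂ, c ≠ 0 ∧ ∀ i, b i = Polynomial.C c * a i := by
  classical
  cases nonempty_fintype ι
  have htop : Ideal.span (Set.range a) = ⊤ := by
    obtain ⟨g, hg⟩ := IsPrincipalIdealRing.principal (Ideal.span (Set.range a))
    have hdvd : ∀ i, g ∣ a i := fun i => by
      rw [← Ideal.mem_span_singleton]
      change a i ∈ Submodule.span _ {g}
      rw [← hg]
      exact Ideal.subset_span ⟨i, rfl⟩
    have hunit : IsUnit g := by
      by_contra hu
      have hdeg : g.degree ≠ 0 := fun h0 => hu (Polynomial.isUnit_iff_degree_eq_zero.2 h0)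
      obtain ⟨s, hs⟩ := IsAlgClosed.exists_root g hdeg
      obtain ⟨i, hi⟩ := ha s
      obtain ⟨r, hr⟩ := hdvd i
      rw [hr, Polynomial.eval_mul, hs.eq_zero, zero_mul] at hi
      exact hi rfl
    rw [hg]
    exact Ideal.span_singleton_eq_top.2 hunit
  have h1 : (1 : Polynomial ℂ) ∈ Ideal.span (Set.range a) := by rw [htop]; trivial
  obtain ⟨u, hu⟩ := (Submodule.mem_span_range_iff_exists_fun _).1 h1
  simp only [smul_eq_mul] at hu
  -- From `∑ u i * a i = 1` and proportionality, `b j = e * a j`. A root of `e` would be a common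
  -- root of the `b j`, so `e` is constant.
  set e := ∑ i, u i * b i with he
  have hbe : ∀ j, b j = e * a j := by
    intro j
    calc b j = (∑ i, u i * a i) * b j := by rw [hu, one_mul]
      _ = e * a j := by
        rw [he, Finset.sum_mul, Finset.sum_mul]
        refine Finset.sum_congr rfl fun i _ => ?_
        rw [mul_assoc, h i j]
        ring
  have hdeg : e.degree = 0 := by
    by_contra hdeg
    obtain ⟨s, hs⟩ := IsAlgClosed.exists_root e hdeg
    obtain ⟨i, hi⟩ := hb s
    rw [hbe, Polynomial.eval_mul, hs.eq_zero, zero_mul] at hi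
    exact hi rfl
  obtain ⟨c, hc, hce⟩ := Polynomial.isUnit_iff.1 (Polynomial.isUnit_iff_degree_eq_zero.2 hdeg)
  exact ⟨c, hc.ne_zero, fun i => by rw [hbe, hce]⟩

/-! ### Linear changes of the parameter -/

/-- The substitution `t ↦ M t` in a polynomial in two variables. -/
noncomputable def linSub (M : Matrix (Fin 2) (Fin 2) ℂ) :
    MvPolynomial (Fin 2) ℂ →ₐ[ℂ] MvPolynomial (Fin 2) ℂ :=
  aeval fun i => ∑ j, C (M i j) * X j

theorem eval_linSub (M : Matrix (Fin 2) (Fin 2) ℂ) (F : MvPolynomial (Fin 2) ℂ)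
    (τ : Fin 2 → ℂ) : eval τ (linSub M F) = eval (M.mulVec τ) F := by
  rw [linSub, aeval_def, hom_eval₂]
  conv_rhs => rw [eval, coe_eval₂Hom]
  congr 1
  · ext; simp
  · ext i
    simp [Matrix.mulVec, dotProduct]

theorem linSub_isHomogeneous (M : Matrix (Fin 2) (Fin 2) ℂ) {F : MvPolynomial (Fin 2) ℂ} {n : ℕ}
    (hF : F.IsHomogeneous n) : (linSub M F).IsHomogeneous n := by
  have := hF.aeval (n := 1) (fun i => ∑ j, C (M i j) * X j)
    (fun i => IsHomogeneous.sum _ _ _ fun j _ => isHomogeneous_C_mul_X _ _)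
  rwa [one_mul] at this

theorem pderiv_linSub (M : Matrix (Fin 2) (Fin 2) ℂ) (k : Fin 2) (F : MvPolynomial (Fin 2) ℂ) :
    pderiv k (linSub M F) = ∑ j, C (M j k) * linSub M (pderiv j F) := by
  induction F using MvPolynomial.induction_on with
  | C a => simp [linSub]
  | add p q hp hq =>
    simp only [map_add, hp, hq, mul_add, Finset.sum_add_distrib]
  | mul_X p i hp =>
    have hX : linSub M (X i) = ∑ j, C (M i j) * X j := by simp [linSub]
    have hX' : pderiv k (linSub M (X i)) = C (M i k) := by
      rw [hX, map_sum, Finset.sum_eq_single k]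
      · simp
      · intro b _ hb
        simp [pderiv_X, hb]
      · simp
    rw [map_mul, Derivation.leibniz, smul_eq_mul, smul_eq_mul, hp, hX']
    simp only [Derivation.leibniz, smul_eq_mul, map_add, map_mul, mul_add,
      Finset.sum_add_distrib]
    congr 1
    · rw [Finset.sum_eq_single i]
      · simp [pderiv_X, mul_comm]
      · intro b _ hb
        simp [pderiv_X, hb.symm]
      · simp
    · rw [Finset.mul_sum]
      refine Finset.sum_congr rfl fun j _ => ?_
      ring

theorem linSub_linSub_inv {M : Matrix (Fin 2) (Fin 2) ℂ} (hM : IsUnit M.det)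
    (F : MvPolynomial (Fin 2) ℂ) : linSub M (linSub M⁻¹ F) = F := by
  refine MvPolynomial.funext fun τ => ?_
  rw [eval_linSub, eval_linSub, Matrix.mulVec_mulVec, Matrix.nonsing_inv_mul _ hM, Matrix.one_mulVec]

theorem mulVec_ne_zero {M : Matrix (Fin 2) (Fin 2) ℂ} (hM : IsUnit M.det) {τ : Fin 2 → ℂ}
    (hτ : τ ≠ 0) : M.mulVec τ ≠ 0 := by
  intro h
  apply hτ
  have := congrArg M⁻¹.mulVec h
  rwa [Matrix.mulVec_mulVec, Matrix.nonsing_inv_mul _ hM, Matrix.one_mulVec, Matrix.mulVec_zero] at this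

theorem evalAt_linSub {n : ℕ} (γ : Fin (n + 1) → MvPolynomial (Fin 2) ℂ)
    (M : Matrix (Fin 2) (Fin 2) ℂ) (τ : Fin 2 → ℂ) :
    evalAt (fun i => linSub M (γ i)) τ = evalAt γ (M.mulVec τ) := by
  ext i
  exact eval_linSub M (γ i) τ

theorem partialAt_linSub {n : ℕ} (γ : Fin (n + 1) → MvPolynomial (Fin 2) ℂ)
    (M : Matrix (Fin 2) (Fin 2) ℂ) (k : Fin 2) (τ : Fin 2 → ℂ) :
    partialAt (fun i => linSub M (γ i)) k τ =
      M 0 k • partialAt γ 0 (M.mulVec τ) + M 1 k • partialAt γ 1 (M.mulVec τ) := by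
  ext i
  simp only [partialAt, pderiv_linSub, Fin.sum_univ_two, map_add, map_mul, eval_C, eval_linSub,
    Pi.add_apply, Pi.smul_apply, smul_eq_mul]

theorem curve_linSub_subset {n : ℕ} (γ : Fin (n + 1) → MvPolynomial (Fin 2) ℂ)
    {M : Matrix (Fin 2) (Fin 2) ℂ} (hM : IsUnit M.det) :
    curve (fun i => linSub M (γ i)) ⊆ curve γ := by
  rintro p ⟨τ, hτ, h⟩
  rw [evalAt_linSub] at h
  exact ⟨_, mulVec_ne_zero hM hτ, h⟩

theorem tangentDevelopable_linSub_subset {n : ℕ} (γ : Fin (n + 1) → MvPolynomial (Fin 2) ℂ)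
    {M : Matrix (Fin 2) (Fin 2) ℂ} (hM : IsUnit M.det) :
    tangentDevelopable (fun i => linSub M (γ i)) ⊆ tangentDevelopable γ := by
  rintro p ⟨τ, hτ, a, b, h⟩
  refine ⟨_, mulVec_ne_zero hM hτ, a * M 0 0 + b * M 0 1, a * M 1 0 + b * M 1 1, ?_⟩
  rw [partialAt_linSub, partialAt_linSub] at h
  convert h using 1
  module

theorem curve_linSub {n : ℕ} (γ : Fin (n + 1) → MvPolynomial (Fin 2) ℂ)
    {M : Matrix (Fin 2) (Fin 2) ℂ} (hM : IsUnit M.det) :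
    curve (fun i => linSub M (γ i)) = curve γ := by
  refine (curve_linSub_subset γ hM).antisymm ?_
  have h := curve_linSub_subset (fun i => linSub M (γ i)) (Matrix.isUnit_nonsing_inv_det M hM)
  have hi := linSub_linSub_inv (Matrix.isUnit_nonsing_inv_det M hM)
  rw [Matrix.nonsing_inv_nonsing_inv _ hM] at hi
  simpa only [hi] using h

theorem tangentDevelopable_linSub {n : ℕ} (γ : Fin (n + 1) → MvPolynomial (Fin 2) ℂ)
    {M : Matrix (Fin 2) (Fin 2) ℂ} (hM : IsUnit M.det) :
    tangentDevelopable (fun i => linSub M (γ i)) = tangentDevelopable γ := by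
  refine (tangentDevelopable_linSub_subset γ hM).antisymm ?_
  have h := tangentDevelopable_linSub_subset (fun i => linSub M (γ i))
    (Matrix.isUnit_nonsing_inv_det M hM)
  have hi := linSub_linSub_inv (Matrix.isUnit_nonsing_inv_det M hM)
  rw [Matrix.nonsing_inv_nonsing_inv _ hM] at hi
  simpa only [hi] using h

/-! ### Proper parametrizations of a plane curve are equivalent -/

/-- Used as evaluation of the composite at infinity: only the coefficients of degree `m` contribute
to degree `d * m`. -/
theorem coeff_aeval_of_isHomogeneous {F : MvPolynomial (Fin 2) ℂ} {d : ℕ} (hF : F.IsHomogeneous d)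
    {f : Fin 2 → Polynomial ℂ} {m : ℕ} (hf : ∀ i, (f i).natDegree ≤ m) :
    (aeval f F).coeff (d * m) = eval (fun i => (f i).coeff m) F := by
  rw [aeval_def, eval₂_eq', eval_eq', Polynomial.finsetSum_coeff]
  refine Finset.sum_congr rfl fun e he => ?_
  have hdeg := hF.degree_eq_sum_deg_support he
  have hd : d = e 0 + e 1 := by
    rw [hdeg, ← Finsupp.degree_apply, Finsupp.degree_eq_sum, Fin.sum_univ_two]
  rw [Fin.prod_univ_two, Fin.prod_univ_two, hd, add_mul]
  change (Polynomial.C _ * _).coeff _ = _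
  rw [Polynomial.coeff_C_mul,
    Polynomial.coeff_mul_add_eq_of_natDegree_le (Polynomial.natDegree_pow_le_of_le _ (hf 0))
      (Polynomial.natDegree_pow_le_of_le _ (hf 1)),
    Polynomial.coeff_pow_of_natDegree_le (hf 0), Polynomial.coeff_pow_of_natDegree_le (hf 1)]

theorem natDegree_aeval_le {F : MvPolynomial (Fin 2) ℂ} {d : ℕ} (hF : F.IsHomogeneous d)
    {f : Fin 2 → Polynomial ℂ} {m : ℕ} (hf : ∀ i, (f i).natDegree ≤ m) :
    (aeval f F).natDegree ≤ d * m :=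
  aeval_natDegree_le F hF.totalDegree_le f hf

theorem eval_aeval_eq (F : MvPolynomial (Fin 2) ℂ) (f : Fin 2 → Polynomial ℂ) (s : ℂ) :
    (aeval f F).eval s = eval (fun i => (f i).eval s) F := by
  rw [← Polynomial.coe_evalRingHom, aeval_def, hom_eval₂]
  conv_rhs => rw [eval, coe_eval₂Hom]
  congr 1
  ext; simp

/-- A binary form of positive degree has a nontrivial zero. -/
theorem exists_zero_of_isHomogeneous {F : MvPolynomial (Fin 2) ℂ} {d : ℕ} (hd : d ≠ 0)
    (hF : F.IsHomogeneous d) : ∃ τ : Fin 2 → ℂ, τ ≠ 0 ∧ eval τ F = 0 := by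
  by_cases h : (dehom F).degree = 0
  · refine ⟨![1, 0], fun h => one_ne_zero (congrFun h 0), ?_⟩
    have h1 := coeff_aeval_of_isHomogeneous hF (f := ![Polynomial.X, 1]) (m := 1) (fun i => by
      fin_cases i <;> simp)
    have h2 : (fun i => (![Polynomial.X, 1] i : Polynomial ℂ).coeff 1) = ![1, 0] := by
      ext i
      fin_cases i <;> simp [Polynomial.coeff_one]
    rw [h2] at h1
    rw [← h1, mul_one]
    refine Polynomial.coeff_eq_zero_of_natDegree_lt ?_
    rw [show aeval ![Polynomial.X, 1] F = dehom F from rfl, Polynomial.natDegree_eq_of_degree_eq_some h]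
    exact Nat.pos_of_ne_zero hd
  · obtain ⟨s, hs⟩ := IsAlgClosed.exists_root _ h
    refine ⟨![s, 1], fun h => one_ne_zero (congrFun h 1), ?_⟩
    rw [← eval_dehom]
    exact hs

theorem exists_smul_of_minors_eq_zero {n : ℕ} {v w : Fin (n + 1) → ℂ} (hw : w ≠ 0)
    (h : ∀ i j, v i * w j = v j * w i) : ∃ c : ℂ, v = c • w := by
  obtain ⟨j, hj⟩ := Function.ne_iff.1 hw
  refine ⟨v j / w j, ?_⟩
  ext i
  have hj' : w j ≠ 0 := hj
  simp only [Pi.smul_apply, smul_eq_mul]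
  field_simp
  exact h i j

/-- An infinite fibre would make `K` a constant vector times a single form, and a zero of that form
would be a base point. -/
theorem evalAt_ne_zero_finite_fibre {d n : ℕ} (hd : d ≠ 0)
    {K : Fin (n + 1) → MvPolynomial (Fin 2) ℂ} (hK : ∀ i, (K i).IsHomogeneous d)
    (hK0 : ∀ τ : Fin 2 → ℂ, τ ≠ 0 → evalAt K τ ≠ 0) (q : PSpace n) :
    ∀ᶠ s in Filter.cofinite, ¬ Represents (evalAt K ![s, 1]) q := by
  by_contra hcon
  have hinf : ∃ᶠ s in Filter.cofinite, Represents (evalAt K ![s, 1]) q := hcon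
  obtain ⟨j, hj⟩ := Function.ne_iff.1 q.rep_nonzero
  have hj' : q.rep j ≠ 0 := hj
  have key : ∀ i, q.rep j • K i - q.rep i • K j = 0 := by
    intro i
    have hh : (q.rep j • K i - q.rep i • K j).IsHomogeneous d :=
      ((homogeneousSubmodule (Fin 2) ℂ d).smul_mem _ (hK i)).sub
        ((homogeneousSubmodule (Fin 2) ℂ d).smul_mem _ (hK j))
    refine eq_zero_of_dehom_eq_zero hh ?_
    by_contra hne
    obtain ⟨s, h1, h2⟩ := (hinf.and_eventually (eventually_eval_ne_zero hne)).exists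
    obtain ⟨c, -, hc⟩ := represents_iff.1 h1
    apply h2
    rw [eval_dehom]
    have ei : eval ![s, 1] (K i) = c * q.rep i := congrFun hc i
    have ej : eval ![s, 1] (K j) = c * q.rep j := congrFun hc j
    rw [map_sub, smul_eval, smul_eval, ei, ej]
    ring
  obtain ⟨τ, hτ, hτ0⟩ := exists_zero_of_isHomogeneous hd (hK j)
  refine hK0 τ hτ ?_
  ext i
  have h := congrArg (eval τ) (key i)
  rw [map_sub, smul_eval, smul_eval, hτ0, mul_zero, sub_zero, map_zero] at h
  exact (mul_eq_zero.1 h).resolve_left hj'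

/-- The points to avoid are the image of `t = ∞`, which the affine chart misses, and the images of
the finitely many parameters where `H` is not injective. Each has only finitely many preimages under
`K`. -/
theorem eventually_existsUnique {d n : ℕ} (hd : d ≠ 0) {H K : Fin (n + 1) → MvPolynomial (Fin 2) ℂ}
    (hH : IsParametrization d H) (hK : ∀ i, (K i).IsHomogeneous d)
    (hK0 : ∀ τ : Fin 2 → ℂ, τ ≠ 0 → evalAt K τ ≠ 0) (hHK : curve K ⊆ curve H) :
    ∀ᶠ s in Filter.cofinite, ∃! t : ℂ, ∀ i j, evalAt H ![t, 1] i * evalAt K ![s, 1] j =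
      evalAt H ![t, 1] j * evalAt K ![s, 1] i := by
  have h1ne : ∀ t : ℂ, (![t, 1] : Fin 2 → ℂ) ≠ 0 := fun t h => one_ne_zero (congrFun h 1)
  set Bad : Set (PSpace n) := {q | Represents (evalAt H ![1, 0]) q} ∪
    ⋃ t ∈ {t : PSpace 1 | ∃ t' : PSpace 1, t' ≠ t ∧ ∃ p : PSpace n,
      Represents (evalAt H t.rep) p ∧ Represents (evalAt H t'.rep) p},
        {q | Represents (evalAt H t.rep) q} with hBad
  have hfin : Bad.Finite := by
    refine Set.Finite.union (Set.Subsingleton.finite fun a ha b hb => Represents.eq ha hb) ?_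
    exact hH.generically_injective.biUnion fun t _ =>
      Set.Subsingleton.finite fun a ha b hb => Represents.eq ha hb
  have hav : ∀ᶠ s in Filter.cofinite, ∀ q ∈ Bad, ¬ Represents (evalAt K ![s, 1]) q :=
    (Filter.eventually_all_finite hfin).2 fun q _ => evalAt_ne_zero_finite_fibre hd hK hK0 q
  filter_upwards [hav] with s hs
  have hKs := hK0 _ (h1ne s)
  set q : PSpace n := Projectivization.mk ℂ _ hKs with hq
  have hKq : Represents (evalAt K ![s, 1]) q := represents_mk hKs
  have hqBad : q ∉ Bad := fun h => hs q h hKq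
  obtain ⟨τ, hτ, hτq⟩ := hHK ⟨_, h1ne s, hKq⟩
  have hτ1 : τ 1 ≠ 0 := by
    intro h0
    have hτ' : τ = τ 0 • ![1, 0] := by
      ext i
      fin_cases i
      · simp
      · simpa using h0
    have hτ0 : τ 0 ≠ 0 := by
      intro h
      rw [h, zero_smul] at hτ'
      exact hτ hτ'
    rw [hτ', evalAt_smul hH.homogeneous] at hτq
    have := hτq.smul (inv_ne_zero (pow_ne_zero d hτ0))
    rw [inv_smul_smul₀ (pow_ne_zero d hτ0)] at this
    exact hqBad (Or.inl this)
  have hrep : ∀ t, (∀ i j, evalAt H ![t, 1] i * evalAt K ![s, 1] j =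
      evalAt H ![t, 1] j * evalAt K ![s, 1] i) → Represents (evalAt H ![t, 1]) q := by
    intro t ht
    obtain ⟨c, hc⟩ := exists_smul_of_minors_eq_zero hKs ht
    have hc0 : c ≠ 0 := by
      rintro rfl
      exact hH.base_point_free _ (h1ne t) (by rw [hc, zero_smul])
    rw [hc]
    exact hKq.smul hc0
  have hex : ∀ i j, evalAt H ![τ 0 / τ 1, 1] i * evalAt K ![s, 1] j =
      evalAt H ![τ 0 / τ 1, 1] j * evalAt K ![s, 1] i := by
    intro i j
    have hτ' : τ = τ 1 • ![τ 0 / τ 1, 1] := by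
      ext i
      fin_cases i
      · exact (mul_div_cancel₀ _ hτ1).symm
      · simp
    rw [hτ', evalAt_smul hH.homogeneous] at hτq
    obtain ⟨c, -, hc⟩ := hτq.exists_smul hKq
    rw [hc]
    simp only [Pi.smul_apply, smul_eq_mul]
    ring
  have huniq : ∀ t t' : ℂ, Represents (evalAt H ![t, 1]) q → Represents (evalAt H ![t', 1]) q →
      t' = t := by
    intro t t' ht ht'
    by_contra hne
    have hrep' : ∀ t : ℂ, Represents (evalAt H ![t, 1]) q →
        Represents (evalAt H (Projectivization.mk ℂ ![t, 1] (h1ne t)).rep) q := by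
      intro t ht
      obtain ⟨a, ha⟩ := Projectivization.exists_smul_eq_mk_rep ℂ ![t, 1] (h1ne t)
      rw [← ha]
      change Represents (evalAt H ((a : ℂ) • ![t, 1])) q
      rw [evalAt_smul hH.homogeneous]
      exact ht.smul (pow_ne_zero _ a.ne_zero)
    refine hqBad (Or.inr (Set.mem_iUnion₂.2 ⟨Projectivization.mk ℂ _ (h1ne t),
      ⟨Projectivization.mk ℂ _ (h1ne t'), ?_, q, hrep' t ht, hrep' t' ht'⟩, hrep' t ht⟩))
    intro h
    obtain ⟨a, ha⟩ := (Projectivization.mk_eq_mk_iff' ℂ _ _ _ _).1 h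
    have e1 : a = 1 := by simpa using congrFun ha 1
    have e0 : a * t = t' := by simpa using congrFun ha 0
    exact hne (by rw [← e0, e1, one_mul])
  exact ⟨_, hex, fun t ht => huniq _ _ (hrep _ hex) (hrep t ht)⟩

/-- If `H` is a proper parametrization by forms of degree `d`, and the curve given by base point
free forms `K` of the same degree lies on the curve of `H`, then `K` arises from `H` by a linear
change of the parameter. -/
theorem exists_linSub_eq {d n : ℕ} (hd : d ≠ 0) {H K : Fin (n + 1) → MvPolynomial (Fin 2) ℂ}
    (hH : IsParametrization d H) (hK : ∀ i, (K i).IsHomogeneous d)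
    (hK0 : ∀ τ : Fin 2 → ℂ, τ ≠ 0 → evalAt K τ ≠ 0) (hHK : curve K ⊆ curve H) :
    ∃ M : Matrix (Fin 2) (Fin 2) ℂ, IsUnit M.det ∧ ∀ i, K i = linSub M (H i) := by
  have hHhom := hH.homogeneous
  set P : Fin (n + 1) × Fin (n + 1) → Polynomial (Polynomial ℂ) := fun ij =>
    (dehom (H ij.1)).map Polynomial.C * Polynomial.C (dehom (K ij.2)) -
      (dehom (H ij.2)).map Polynomial.C * Polynomial.C (dehom (K ij.1)) with hP
  have hPev : ∀ ij s t, ((P ij).map (Polynomial.evalRingHom s)).eval t =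
      evalAt H ![t, 1] ij.1 * evalAt K ![s, 1] ij.2 -
        evalAt H ![t, 1] ij.2 * evalAt K ![s, 1] ij.1 := by
    intro ij s t
    have hid : (Polynomial.evalRingHom s).comp Polynomial.C = RingHom.id ℂ := by
      ext; simp
    simp only [hP, Polynomial.map_sub, Polynomial.map_mul, Polynomial.map_map, Polynomial.map_C,
      Polynomial.eval_sub, Polynomial.eval_mul, Polynomial.eval_C, hid, Polynomial.map_id,
      Polynomial.coe_evalRingHom, eval_dehom, evalAt]
  -- The `2 × 2` minors of `H(t)` and `K(s)` vanish together exactly when both represent the same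
  -- point, so `t = p/q` is the rational map with `H ∘ (p : q) = K`.
  obtain ⟨p, q, hq, hcop, hpq⟩ := exists_rational_root P (by
    filter_upwards [eventually_existsUnique hd hH hK hK0 hHK] with s hs
    simpa only [hPev, Prod.forall, sub_eq_zero] using hs)
  set a : Fin (n + 1) → Polynomial ℂ := fun i => aeval ![p, q] (H i) with ha
  have hfun : ∀ s : ℂ, (fun i => (![p, q] i : Polynomial ℂ).eval s) = ![p.eval s, q.eval s] := by
    intro s; ext i; fin_cases i <;> rfl
  have haev : ∀ i s, (a i).eval s = evalAt H ![p.eval s, q.eval s] i := by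
    intro i s
    simp only [ha, eval_aeval_eq, hfun, evalAt]
  obtain ⟨c, hc, hKa⟩ := exists_eq_C_mul_of_no_common_root a (fun i => dehom (K i))
    (by
      intro s
      have hne : (![p.eval s, q.eval s] : Fin 2 → ℂ) ≠ 0 := by
        intro h
        obtain ⟨u, v, huv⟩ := hcop
        have := congrArg (Polynomial.eval s) huv
        have h0 : p.eval s = 0 := congrFun h 0
        have h1 : q.eval s = 0 := congrFun h 1
        simp [h0, h1] at this
      obtain ⟨i, hi⟩ := Function.ne_iff.1 (hH.base_point_free _ hne)
      exact ⟨i, by rw [haev]; exact hi⟩)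
    (by
      intro s
      obtain ⟨i, hi⟩ := Function.ne_iff.1 (hK0 ![s, 1] fun h => one_ne_zero (congrFun h 1))
      exact ⟨i, by rw [eval_dehom]; exact hi⟩)
    (by
      intro i j
      rw [← sub_eq_zero]
      refine eq_zero_of_eventually_eval_eq_zero ?_
      filter_upwards [hpq] with s hs
      have h := hs.2 (i, j)
      rw [hPev] at h
      have hv : (![p.eval s, q.eval s] : Fin 2 → ℂ) = q.eval s • ![p.eval s / q.eval s, 1] := by
        ext k
        fin_cases k
        · exact (mul_div_cancel₀ _ hs.1).symm
        · simp
      rw [Polynomial.eval_sub, Polynomial.eval_mul, Polynomial.eval_mul, haev, haev, eval_dehom,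
        eval_dehom, hv, evalAt_smul hHhom]
      simp only [Pi.smul_apply, smul_eq_mul]
      change _ = (0 : ℂ)
      simp only [evalAt] at h ⊢
      linear_combination (q.eval s) ^ d * h)
  set m := max p.natDegree q.natDegree with hm
  have hpqm : ∀ i, (![p, q] i : Polynomial ℂ).natDegree ≤ m := by
    intro i
    fin_cases i
    · exact le_max_left _ _
    · exact le_max_right _ _
  have hfunc : ∀ r, (fun i => (![p, q] i : Polynomial ℂ).coeff r) = ![p.coeff r, q.coeff r] := by
    intro s; ext i; fin_cases i <;> rfl
  have hlead : (![p.coeff m, q.coeff m] : Fin 2 → ℂ) ≠ 0 := by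
    intro h
    have h0 : p.coeff m = 0 := congrFun h 0
    have h1 : q.coeff m = 0 := congrFun h 1
    rcases le_total p.natDegree q.natDegree with hle | hle
    · rw [hm, max_eq_right hle] at h1
      exact hq (Polynomial.leadingCoeff_eq_zero.1 h1)
    · rw [hm, max_eq_left hle] at h0
      have hp0 := Polynomial.leadingCoeff_eq_zero.1 h0
      rw [hp0, Polynomial.natDegree_zero, Nat.le_zero] at hle
      rw [hm, hp0, hle, Polynomial.natDegree_zero, max_self] at h1
      rw [← hle] at h1
      exact hq (Polynomial.leadingCoeff_eq_zero.1 h1)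
  have hXm : ∀ i, (![Polynomial.X, 1] i : Polynomial ℂ).natDegree ≤ 1 := by
    intro i
    fin_cases i <;> simp
  have hX1 : (fun i => (![Polynomial.X, 1] i : Polynomial ℂ).coeff 1) = ![1, 0] := by
    ext i
    fin_cases i <;> simp [Polynomial.coeff_one]
  -- `m` is the degree of the reparametrization. If `m = 0`, then `K` vanishes at infinity; if `m ≥
  -- 2`, then `H` vanishes at the vector of leading coefficients, since `K` has degree only `d`.
  have hm1 : m = 1 := by
    rcases lt_trichotomy m 1 with h | h | h
    · exfalso
      obtain ⟨i, hi⟩ := Function.ne_iff.1 (hK0 ![1, 0] fun h => one_ne_zero (congrFun h 0))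
      apply hi
      have e1 := coeff_aeval_of_isHomogeneous (hK i) hXm
      rw [hX1, mul_one] at e1
      change (dehom (K i)).coeff d = _ at e1
      rw [hKa, Polynomial.coeff_C_mul, Polynomial.coeff_eq_zero_of_natDegree_lt, mul_zero] at e1
      · exact e1.symm
      · refine (natDegree_aeval_le (hHhom i) hpqm).trans_lt ?_
        rw [Nat.lt_one_iff.1 h, mul_zero]
        exact Nat.pos_of_ne_zero hd
    · exact h
    · exfalso
      obtain ⟨i, hi⟩ := Function.ne_iff.1 (hH.base_point_free _ hlead)
      apply hi
      have e1 := coeff_aeval_of_isHomogeneous (hHhom i) hpqm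
      rw [hfunc] at e1
      have e2 : (dehom (K i)).coeff (d * m) = 0 := by
        refine Polynomial.coeff_eq_zero_of_natDegree_lt
          ((natDegree_aeval_le (hK i) hXm).trans_lt ?_)
        exact Nat.mul_lt_mul_of_pos_left h (Nat.pos_of_ne_zero hd)
      rw [hKa, Polynomial.coeff_C_mul] at e2
      exact e1.symm.trans ((mul_eq_zero.1 e2).resolve_left hc)
  -- A `d`-th root of `c` absorbs the scalar into the linear substitution.
  obtain ⟨μ, hμ⟩ := IsAlgClosed.exists_pow_nat_eq c (Nat.pos_of_ne_zero hd)
  set M : Matrix (Fin 2) (Fin 2) ℂ := !![μ * p.coeff 1, μ * p.coeff 0; μ * q.coeff 1, μ * q.coeff 0]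
    with hM
  have hlin : ∀ r : Polynomial ℂ, r.natDegree ≤ m → ∀ s, r.eval s = r.coeff 1 * s + r.coeff 0 := by
    intro r hr s
    rw [Polynomial.eq_X_add_C_of_natDegree_le_one (hr.trans hm1.le)]
    simp
  have hKM : ∀ i, K i = linSub M (H i) := by
    intro i
    rw [← sub_eq_zero]
    refine eq_zero_of_dehom_eq_zero ((hK i).sub (linSub_isHomogeneous M (hHhom i)))
      (Polynomial.funext fun s => ?_)
    have hMv : M.mulVec ![s, 1] = μ • ![p.eval s, q.eval s] := by
      rw [hlin p (le_max_left _ _), hlin q (le_max_right _ _)]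
      ext k
      fin_cases k
      · simp [hM, Matrix.mulVec, dotProduct]; ring
      · simp [hM, Matrix.mulVec, dotProduct]; ring
    rw [map_sub, hKa, Polynomial.eval_sub, Polynomial.eval_mul, Polynomial.eval_C, haev, eval_dehom,
      eval_linSub, hMv, eval_smul_of_isHomogeneous (hHhom i), hμ, Polynomial.eval_zero]
    exact sub_self _
  refine ⟨M, ?_, hKM⟩
  rw [isUnit_iff_ne_zero]
  intro hdet
  obtain ⟨v, hv, hMv⟩ := Matrix.exists_mulVec_eq_zero_iff.2 hdet
  refine hK0 v hv ?_
  ext i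
  change eval v (K i) = 0
  rw [hKM, eval_linSub, hMv, ← zero_smul ℂ (0 : Fin 2 → ℂ), eval_smul_of_isHomogeneous (hHhom i),
    zero_pow hd, zero_mul]

/-! ### Cones over rational curves -/

/-- Three binary forms of the same positive degree satisfy a homogeneous equation. -/
theorem exists_homogeneous_relation {d : ℕ} (hd : d ≠ 0) {k : Fin 3 → MvPolynomial (Fin 2) ℂ}
    (hk : ∀ i, (k i).IsHomogeneous d) :
    ∃ (F : MvPolynomial (Fin 3) ℂ) (n : ℕ), F ≠ 0 ∧ F.IsHomogeneous n ∧ aeval k F = 0 := by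
  have hdep : ¬ AlgebraicIndependent ℂ k := by
    intro h
    have h1 := h.cardinalMk_le_trdeg
    rw [MvPolynomial.trdeg_of_isDomain] at h1
    simp at h1
    norm_cast at h1
  obtain ⟨F, hF, hF0⟩ : ∃ F, aeval k F = 0 ∧ F ≠ 0 := by
    rw [algebraicIndependent_iff] at hdep
    push Not at hdep
    exact hdep
  obtain ⟨n, hn⟩ : ∃ n, homogeneousComponent n F ≠ 0 := by
    by_contra! h
    apply hF0
    rw [← sum_homogeneousComponent F]
    exact Finset.sum_eq_zero fun i _ => h i
  refine ⟨homogeneousComponent n F, n, hn, homogeneousComponent_isHomogeneous n F, ?_⟩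
  have hhom : ∀ m, (aeval k (homogeneousComponent m F)).IsHomogeneous (d * m) := fun m =>
    (homogeneousComponent_isHomogeneous m F).aeval k hk
  have hmem : n ∈ Finset.range (F.totalDegree + 1) := by
    rw [Finset.mem_range]
    by_contra hlt
    exact hn (homogeneousComponent_eq_zero _ _ (by omega))
  -- The homogeneous components of `F` are sent to distinct degrees `d * m`, so each is itself a
  -- relation.
  have h := congrArg (fun G => homogeneousComponent (d * n) (aeval k G)) (sum_homogeneousComponent F)
  simp only [map_sum, hF, map_zero] at h
  rw [Finset.sum_eq_single n] at h
  · rwa [homogeneousComponent_of_mem (hhom n), if_pos rfl] at h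
  · intro m _ hmn
    rw [homogeneousComponent_of_mem (hhom m), if_neg]
    intro h
    exact hmn (Nat.eq_of_mul_eq_mul_left (Nat.pos_of_ne_zero hd) h).symm
  · exact fun h => absurd hmem h

/-- The cone over a rational space curve with a given vertex lies on a surface. -/
theorem exists_cone {d : ℕ} (hd : d ≠ 0) {γ : Fin 4 → MvPolynomial (Fin 2) ℂ}
    (hγ : ∀ i, (γ i).IsHomogeneous d) (w : Fin 4 → ℂ) (hw : w ≠ 0) :
    ∃ (G : MvPolynomial (Fin 4) ℂ) (n : ℕ), G ≠ 0 ∧ G.IsHomogeneous n ∧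
      ∀ (τ : Fin 2 → ℂ) (c : ℂ), eval (evalAt (n := 3) γ τ - c • w) G = 0 := by
  obtain ⟨j, hj⟩ := Function.ne_iff.1 hw
  have hj' : w j ≠ 0 := hj
  obtain ⟨F, n, hF0, hF, hFk⟩ := exists_homogeneous_relation hd
    -- These are the coordinates of the projection from `w`; an equation of the projected curve,
    -- pulled back, defines the cone.
    (k := fun i => w j • γ (j.succAbove i) - w (j.succAbove i) • γ j) (fun i =>
      ((homogeneousSubmodule (Fin 2) ℂ d).smul_mem _ (hγ _)).sub
        ((homogeneousSubmodule (Fin 2) ℂ d).smul_mem _ (hγ _)))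
  set B : Fin 3 → MvPolynomial (Fin 4) ℂ := fun i =>
    C (w j) * X (j.succAbove i) - C (w (j.succAbove i)) * X j with hB
  have hev : ∀ v, eval v (aeval B F) =
      eval (fun i => w j * v (j.succAbove i) - w (j.succAbove i) * v j) F := by
    intro v
    rw [aeval_def, hom_eval₂]
    conv_rhs => rw [eval, coe_eval₂Hom]
    congr 1
    · ext; simp
    · ext i
      simp [hB]
  refine ⟨aeval B F, 1 * n, ?_, hF.aeval B fun i =>
    (isHomogeneous_C_mul_X _ _).sub (isHomogeneous_C_mul_X _ _), ?_⟩
  · intro h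
    apply hF0
    refine MvPolynomial.funext fun u => ?_
    have h1 := hev (j.insertNth 0 fun i => u i / w j)
    rw [h, map_zero] at h1
    simp only [Fin.insertNth_apply_succAbove, Fin.insertNth_apply_same, mul_zero, sub_zero,
      mul_div_cancel₀ _ hj'] at h1
    rw [← h1, map_zero]
  · intro τ c
    have h2 := congrArg (eval τ) hFk
    rw [map_zero, aeval_def, hom_eval₂] at h2
    rw [hev, ← h2]
    rw [eval, coe_eval₂Hom]
    congr 1
    · ext; simp
    · ext i
      simp [evalAt, smul_eval]
      ring

/-! ### Linear combinations of parametrizing forms -/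

theorem iterate_pderiv_sum {ι : Type*} (s : Finset ι) (k : Fin 2) (m : ℕ)
    (g : ι → MvPolynomial (Fin 2) ℂ) :
    (pderiv k)^[m] (∑ i ∈ s, g i) = ∑ i ∈ s, (pderiv k)^[m] (g i) := by
  induction m with
  | zero => rfl
  | succ m ih => simp only [Function.iterate_succ_apply', ih, map_sum]

theorem iterate_pderiv_isHomogeneous {F : MvPolynomial (Fin 2) ℂ} {n : ℕ} (hF : F.IsHomogeneous n)
    (k : Fin 2) (m : ℕ) : ((pderiv k)^[m] F).IsHomogeneous (n - m) := by
  induction m with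
  | zero => exact hF
  | succ m ih =>
    rw [Function.iterate_succ_apply', Nat.sub_add_eq]
    exact ih.pderiv

theorem det_thirdDerivMatrix_isHomogeneous {d : ℕ} {f : Fin 4 → MvPolynomial (Fin 2) ℂ}
    (hf : ∀ i, (f i).IsHomogeneous d) : (thirdDerivMatrix f).det.IsHomogeneous (4 * (d - 3)) := by
  rw [Matrix.det_apply']
  refine IsHomogeneous.sum _ _ _ fun σ _ => ?_
  rw [← map_intCast (C (R := ℂ) (σ := Fin 2))]
  refine IsHomogeneous.C_mul ?_ _
  have h := IsHomogeneous.prod Finset.univ (fun i => thirdDerivMatrix f (σ i) i)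
    (fun _ => d - 3) (fun i _ => by
      have := iterate_pderiv_isHomogeneous (iterate_pderiv_isHomogeneous (hf (σ i)) 1 (i : ℕ)) 0
        (3 - (i : ℕ))
      rwa [Nat.sub_sub, Nat.add_sub_cancel' (by omega)] at this)
  simpa using h

theorem thirdDerivMatrix_mul (g : Matrix (Fin 4) (Fin 4) ℂ) (f : Fin 4 → MvPolynomial (Fin 2) ℂ) :
    thirdDerivMatrix (fun i => ∑ j, g i j • f j) = g.map C * thirdDerivMatrix f := by
  ext1 i j
  simp only [thirdDerivMatrix, iterate_pderiv_sum, iterate_pderiv_smul, Matrix.mul_apply,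
    Matrix.map_apply]
  simp only [smul_eq_C_mul]

theorem det_thirdDerivMatrix_mul (g : Matrix (Fin 4) (Fin 4) ℂ)
    (f : Fin 4 → MvPolynomial (Fin 2) ℂ) :
    (thirdDerivMatrix (fun i => ∑ j, g i j • f j)).det = C g.det * (thirdDerivMatrix f).det := by
  rw [thirdDerivMatrix_mul, Matrix.det_mul, ← RingHom.mapMatrix_apply, ← RingHom.map_det]

theorem evalAt_combination {m n : ℕ} (g : Matrix (Fin (m + 1)) (Fin (n + 1)) ℂ)
    (f : Fin (n + 1) → MvPolynomial (Fin 2) ℂ) (τ : Fin 2 → ℂ) :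
    evalAt (fun i => ∑ j, g i j • f j) τ = g.mulVec (evalAt f τ) := by
  ext i
  simp only [evalAt, map_sum, smul_eval, Matrix.mulVec, dotProduct]

theorem partialAt_combination {m n : ℕ} (g : Matrix (Fin (m + 1)) (Fin (n + 1)) ℂ)
    (f : Fin (n + 1) → MvPolynomial (Fin 2) ℂ) (k : Fin 2) (τ : Fin 2 → ℂ) :
    partialAt (fun i => ∑ j, g i j • f j) k τ = g.mulVec (partialAt f k τ) := by
  ext i
  simp only [partialAt, map_sum, Derivation.map_smul, smul_eval, Matrix.mulVec, dotProduct]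

/-! ### Projective transformations of curves and tangent developables -/

theorem represents_map {g : (Fin 4 → ℂ) ≃ₗ[ℂ] (Fin 4 → ℂ)} {v : Fin 4 → ℂ} {p : PSpace 3}
    (h : Represents (n := 3) v p) :
    Represents (n := 3) (g v) (Projectivization.map g.toLinearMap g.injective p) := by
  obtain ⟨hv, rfl⟩ := h
  exact ⟨by simpa using hv, rfl⟩

theorem mem_transform_iff {g : (Fin 4 → ℂ) ≃ₗ[ℂ] (Fin 4 → ℂ)} {X : Set (PSpace 3)} {p : PSpace 3} :
    p ∈ transform g X ↔ ∃ q ∈ X, ∃ v, Represents (n := 3) v q ∧ Represents (n := 3) (g v) p := by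
  constructor
  · rintro ⟨q, hq, rfl⟩
    exact ⟨q, hq, q.rep, represents_rep q, represents_map (represents_rep q)⟩
  · rintro ⟨q, hq, v, hv, hp⟩
    exact ⟨q, hq, (represents_map hv).eq hp⟩

theorem transform_curve {g : (Fin 4 → ℂ) ≃ₗ[ℂ] (Fin 4 → ℂ)} {f f' : Fin 4 → MvPolynomial (Fin 2) ℂ}
    (h : ∀ τ, evalAt (n := 3) f' τ = g (evalAt (n := 3) f τ)) :
    transform g (curve (n := 3) f) = curve (n := 3) f' := by
  ext p
  rw [mem_transform_iff]
  constructor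
  · rintro ⟨q, ⟨τ, hτ, hq⟩, v, hv, hp⟩
    obtain ⟨c, hc, e⟩ := hv.exists_smul hq
    refine ⟨τ, hτ, ?_⟩
    rw [h, e, map_smul]
    exact hp.smul hc
  · rintro ⟨τ, hτ, hp⟩
    rw [h] at hp
    have h0 : evalAt (n := 3) f τ ≠ 0 := fun h0 => hp.ne_zero (by rw [h0, map_zero])
    exact ⟨_, ⟨τ, hτ, represents_mk h0⟩, _, represents_mk h0, hp⟩

theorem transform_tangentDevelopable {g : (Fin 4 → ℂ) ≃ₗ[ℂ] (Fin 4 → ℂ)}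
    {f f' : Fin 4 → MvPolynomial (Fin 2) ℂ}
    (h : ∀ k τ, partialAt (n := 3) f' k τ = g (partialAt (n := 3) f k τ)) :
    transform g (tangentDevelopable (n := 3) f) = tangentDevelopable (n := 3) f' := by
  ext p
  rw [mem_transform_iff]
  constructor
  · rintro ⟨q, ⟨τ, hτ, a, b, hq⟩, v, hv, hp⟩
    obtain ⟨c, hc, e⟩ := hv.exists_smul hq
    refine ⟨τ, hτ, a, b, ?_⟩
    rw [h, h, ← map_smul, ← map_smul, ← map_add, e, map_smul]
    exact hp.smul hc
  · rintro ⟨τ, hτ, a, b, hp⟩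
    rw [h, h, ← map_smul, ← map_smul, ← map_add] at hp
    have h0 : a • partialAt (n := 3) f 0 τ + b • partialAt (n := 3) f 1 τ ≠ 0 :=
      fun h0 => hp.ne_zero (by rw [h0, map_zero])
    exact ⟨_, ⟨τ, hτ, a, b, represents_mk h0⟩, _, represents_mk h0, hp⟩

theorem IsEmbedding.exists_smul {d n : ℕ} {f : Fin (n + 1) → MvPolynomial (Fin 2) ℂ}
    (hf : ∀ i, (f i).IsHomogeneous d) (he : IsEmbedding f) {τ τ' : Fin 2 → ℂ} (hτ : τ ≠ 0)
    (hτ' : τ' ≠ 0) {p : PSpace n} (h : Represents (evalAt f τ) p) (h' : Represents (evalAt f τ') p) :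
    ∃ c : ℂ, τ' = c • τ := by
  have hrep : ∀ (τ : Fin 2 → ℂ) (hτ : τ ≠ 0), Represents (evalAt f τ) p →
      Represents (evalAt f (Projectivization.mk ℂ τ hτ).rep) p := by
    intro τ hτ h
    obtain ⟨a, ha⟩ := Projectivization.exists_smul_eq_mk_rep ℂ τ hτ
    rw [← ha]
    change Represents (evalAt f ((a : ℂ) • τ)) p
    rw [evalAt_smul hf]
    exact h.smul (pow_ne_zero _ a.ne_zero)
  have := he.injective _ _ p (hrep τ' hτ' h') (hrep τ hτ h)
  obtain ⟨c, hc⟩ := (Projectivization.mk_eq_mk_iff' ℂ _ _ _ _).1 this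
  exact ⟨c, hc.symm⟩

/-! ### The linear system -/

/-- The rows of the matrix of a linear map from `ℂ⁴` to `ℂ³`. -/
def coordRows (A : (Fin 4 → ℂ) →ₗ[ℂ] (Fin 3 → ℂ)) : Fin 3 → Fin 4 → ℂ :=
  fun i j => A (Pi.single j 1) i

theorem sum_coordRows (A : (Fin 4 → ℂ) →ₗ[ℂ] (Fin 3 → ℂ)) (v : Fin 4 → ℂ) (i : Fin 3) :
    ∑ j, coordRows A i j * v j = A v i := by
  conv_rhs => rw [LinearMap.pi_apply_eq_sum_univ A v]
  rw [Finset.sum_apply]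
  refine Finset.sum_congr rfl fun j _ => ?_
  have hj : (fun l => if j = l then (1 : ℂ) else 0) = Pi.single j 1 := by
    ext l
    simp [Pi.single_apply, eq_comm]
  rw [Pi.smul_apply, smul_eq_mul, mul_comm, coordRows, hj]

theorem linearIndependent_coordRows {A : (Fin 4 → ℂ) →ₗ[ℂ] (Fin 3 → ℂ)}
    (hA : Function.Surjective A) : LinearIndependent ℂ (coordRows A) := by
  rw [Fintype.linearIndependent_iff]
  intro c hc i
  obtain ⟨v, hv⟩ := hA (Pi.single i 1)
  have h : ∑ k, c k * A v k = 0 := by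
    simp only [← sum_coordRows, Finset.mul_sum]
    rw [Finset.sum_comm]
    refine Finset.sum_eq_zero fun j _ => ?_
    have := congrFun hc j
    simp only [Finset.sum_apply, Pi.smul_apply, smul_eq_mul, Pi.zero_apply] at this
    simp only [← mul_assoc, ← Finset.sum_mul, this, zero_mul]
  rw [hv] at h
  simpa [Pi.single_apply] using h

/-- The square matrix with rows `a 0, a 1, a 2, b`. -/
def addRow (a : Fin 3 → Fin 4 → ℂ) (b : Fin 4 → ℂ) : Matrix (Fin 4) (Fin 4) ℂ :=
  Matrix.of (Fin.snoc (α := fun _ => Fin 4 → ℂ) a b)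

theorem addRow_castSucc (a : Fin 3 → Fin 4 → ℂ) (b : Fin 4 → ℂ) (i : Fin 3) (j : Fin 4) :
    addRow a b i.castSucc j = a i j := by
  rw [addRow, Matrix.of_apply, Fin.snoc_castSucc]

theorem addRow_last (a : Fin 3 → Fin 4 → ℂ) (b : Fin 4 → ℂ) (j : Fin 4) :
    addRow a b (Fin.last 3) j = b j := by
  rw [addRow, Matrix.of_apply, Fin.snoc_last]

theorem isUnit_addRow {a : Fin 3 → Fin 4 → ℂ} {b : Fin 4 → ℂ} (ha : LinearIndependent ℂ a)
    (hb : b ∉ Submodule.span ℂ (Set.range a)) : IsUnit (addRow a b) :=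
  Matrix.linearIndependent_rows_iff_isUnit.1 (linearIndependent_finSnoc.2 ⟨ha, hb⟩)

theorem extend_eq_snoc (H : Fin 3 → MvPolynomial (Fin 2) ℂ) (h : MvPolynomial (Fin 2) ℂ) :
    extend H h = Fin.snoc (α := fun _ => MvPolynomial (Fin 2) ℂ) H h := by
  ext1 i
  fin_cases i <;> rfl

theorem extend_eq_combination {a : Fin 3 → Fin 4 → ℂ} {f : Fin 4 → MvPolynomial (Fin 2) ℂ}
    {H : Fin 3 → MvPolynomial (Fin 2) ℂ} (hH : ∀ i, H i = ∑ j, a i j • f j) (b : Fin 4 → ℂ) :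
    extend H (∑ j, b j • f j) = fun i => ∑ j, addRow a b i j • f j := by
  rw [extend_eq_snoc]
  funext i
  refine Fin.lastCases ?_ (fun i => ?_) i
  · simp only [addRow_last]
    rw [Fin.snoc_last]
  · simp only [addRow_castSucc]
    rw [Fin.snoc_castSucc, hH]

theorem extend_isHomogeneous {d : ℕ} {H : Fin 3 → MvPolynomial (Fin 2) ℂ}
    (hH : ∀ i, (H i).IsHomogeneous d) {h : MvPolynomial (Fin 2) ℂ} (hh : h.IsHomogeneous d)
    (i : Fin 4) : (extend H h i).IsHomogeneous d := by
  rw [extend_eq_snoc]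
  refine Fin.lastCases ?_ (fun i => ?_) i
  · rwa [Fin.snoc_last]
  · rw [Fin.snoc_castSucc]
    exact hH i

/-- A rational space curve with `4(d - 3)` marked points at which the determinant of the third
derivatives vanishes, and a projection to the plane that separates the marked points from all other
points of the curve. -/
structure MarkedProjection (d : ℕ) (f : Fin 4 → MvPolynomial (Fin 2) ℂ) (P : Set (PSpace 3))
    (A : (Fin 4 → ℂ) →ₗ[ℂ] (Fin 3 → ℂ)) (H : Fin 3 → MvPolynomial (Fin 2) ℂ) : Prop where
  three_le : 3 ≤ d
  homogeneous : ∀ i, (f i).IsHomogeneous d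
  linearIndependent : LinearIndependent ℂ f
  injective : ∀ (τ τ' : Fin 2 → ℂ) (p : PSpace 3), τ ≠ 0 → τ' ≠ 0 →
    Represents (n := 3) (evalAt f τ) p → Represents (n := 3) (evalAt f τ') p → ∃ c : ℂ, τ' = c • τ
  encard_eq : P.encard = ((4 * (d - 3) : ℕ) : ℕ∞)
  det_eq_zero : ∀ p ∈ P, ∃ τ : Fin 2 → ℂ, τ ≠ 0 ∧ Represents (n := 3) (evalAt f τ) p ∧
    eval τ (thirdDerivMatrix f).det = 0
  surjective : Function.Surjective A
  base_point_free : ∀ τ : Fin 2 → ℂ, τ ≠ 0 → A (evalAt (n := 3) f τ) ≠ 0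
  separates : ∀ p ∈ P, ∀ (w : Fin 4 → ℂ) (τ : Fin 2 → ℂ) (c : ℂ), τ ≠ 0 →
    Represents (n := 3) w p → A (evalAt (n := 3) f τ) = c • A w → evalAt (n := 3) f τ = c • w
  projection : ∀ i, H i = ∑ j, coordRows A i j • f j

namespace MarkedProjection

variable {d : ℕ} {f : Fin 4 → MvPolynomial (Fin 2) ℂ} {P : Set (PSpace 3)}
  {A : (Fin 4 → ℂ) →ₗ[ℂ] (Fin 3 → ℂ)} {H : Fin 3 → MvPolynomial (Fin 2) ℂ}

theorem evalAt_projection (m : MarkedProjection d f P A H) (τ : Fin 2 → ℂ) :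
    evalAt (n := 2) H τ = A (evalAt (n := 3) f τ) := by
  ext i
  rw [← sum_coordRows]
  simp only [evalAt, m.projection, map_sum, smul_eval]

/-- Marked points are points of the curve, so separation makes the projection injective on them. -/
theorem encard_projImage (m : MarkedProjection d f P A H) :
    (projImage A P).encard = ((4 * (d - 3) : ℕ) : ℕ∞) := by
  have : Nonempty (PSpace 2) := ⟨Projectivization.mk ℂ (fun _ => 1) fun h =>
    one_ne_zero (congrFun h 0)⟩
  have hex : ∀ p ∈ P, ∃ q, Represents (n := 2) (A p.rep) q := by
    intro p hp
    obtain ⟨τ, hτ, hrep, -⟩ := m.det_eq_zero p hp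
    obtain ⟨c, -, hc⟩ := represents_iff.1 hrep
    have h0 : A p.rep ≠ 0 := by
      intro h0
      refine m.base_point_free τ hτ ?_
      rw [hc, map_smul, h0, smul_zero]
    exact ⟨_, represents_mk h0⟩
  choose! φ hφ using hex
  have himage : projImage A P = φ '' P := by
    ext q
    constructor
    · rintro ⟨p, hp, v, hv, hq⟩
      obtain ⟨c, hc, rfl⟩ := represents_iff.1 hv
      refine ⟨p, hp, ?_⟩
      rw [map_smul] at hq
      exact ((hφ p hp).smul hc).eq hq
    · rintro ⟨p, hp, rfl⟩
      exact ⟨p, hp, p.rep, represents_rep p, hφ p hp⟩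
  rw [himage, Set.InjOn.encard_image, m.encard_eq]
  intro p hp p' hp' h
  obtain ⟨τ, hτ, hrep, -⟩ := m.det_eq_zero p hp
  obtain ⟨c, hc0, hc⟩ := represents_iff.1 hrep
  have h1 := hφ p hp
  rw [h] at h1
  obtain ⟨e, he0, he⟩ := (hφ p' hp').exists_smul h1
  have h2 := m.separates p' hp' p'.rep τ (c * e) hτ (represents_rep p')
    (by rw [hc, map_smul, he, smul_smul])
  rw [h2] at hrep
  exact hrep.eq ((represents_rep p').smul (mul_ne_zero hc0 he0))

theorem projection_isHomogeneous (m : MarkedProjection d f P A H) (i : Fin 3) :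
    (H i).IsHomogeneous d := by
  rw [m.projection]
  exact IsHomogeneous.sum _ _ _ fun j _ =>
    (homogeneousSubmodule (Fin 2) ℂ d).smul_mem _ (m.homogeneous j)

theorem linearIndependent_projection (m : MarkedProjection d f P A H) : LinearIndependent ℂ H := by
  have h := (linearIndependent_coordRows m.surjective).map'
    (Fintype.linearCombination ℂ f)
    (LinearMap.ker_eq_bot.2 m.linearIndependent.fintypeLinearCombination_injective)
  rwa [show H = Fintype.linearCombination ℂ f ∘ coordRows A from funext m.projection]

/-- The matrix for `H, h` is a constant matrix times that of `f`. By separation, a parameter mapped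
into the projected marked set belongs to a marked point, where the determinant of `f` vanishes. -/
theorem combination_mem_solutionSpace (m : MarkedProjection d f P A H) (b : Fin 4 → ℂ) :
    ∑ j, b j • f j ∈ solutionSpace d H (projImage A P) := by
  refine ⟨IsHomogeneous.sum _ _ _ fun j _ =>
    (homogeneousSubmodule (Fin 2) ℂ d).smul_mem _ (m.homogeneous j), ?_⟩
  rintro τ ⟨q, ⟨p, hp, v, hv, hvq⟩, hτq⟩
  have hd0 : d ≠ 0 := by have := m.three_le; omega
  have hτ : τ ≠ 0 := by
    rintro rfl
    apply hτq.ne_zero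
    rw [← zero_smul ℂ (0 : Fin 2 → ℂ), evalAt_smul m.projection_isHomogeneous, zero_pow hd0, zero_smul]
  rw [m.evalAt_projection] at hτq
  obtain ⟨c, hc, hcv⟩ := hvq.exists_smul hτq
  have hfτ := m.separates p hp v τ c hτ hv hcv
  obtain ⟨τ', hτ', hrep, h0⟩ := m.det_eq_zero p hp
  obtain ⟨e, he⟩ := m.injective τ' τ p hτ' hτ hrep (by rw [hfτ]; exact hv.smul hc)
  rw [extend_eq_combination m.projection, det_thirdDerivMatrix_mul, map_mul, he,
    eval_smul_of_isHomogeneous (det_thirdDerivMatrix_isHomogeneous m.homogeneous), h0, mul_zero,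
    mul_zero]

theorem solutionSpace_le (m : MarkedProjection d f P A H) :
    solutionSpace d H (projImage A P) ≤ LinearMap.range (Fintype.linearCombination ℂ f) := by
  rintro h ⟨hh, hdet⟩
  have hW0 : (thirdDerivMatrix f).det ≠ 0 := fun h0 =>
    not_linearIndependent_of_det_eq_zero m.three_le m.homogeneous h0 m.linearIndependent
  choose! τ hτ hrep hWτ using m.det_eq_zero
  have hfin : P.Finite := Set.finite_of_encard_eq_coe m.encard_eq
  have hcard : hfin.toFinset.card = 4 * (d - 3) := by
    have := m.encard_eq
    rw [hfin.encard_eq_coe_toFinset_card] at this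
    exact_mod_cast this
  obtain ⟨c, hc⟩ := exists_eq_smul_of_card_roots
    (det_thirdDerivMatrix_isHomogeneous m.homogeneous)
    (det_thirdDerivMatrix_isHomogeneous (extend_isHomogeneous m.projection_isHomogeneous hh)) hW0
    hfin.toFinset hcard τ (fun p hp => hτ p (hfin.mem_toFinset.1 hp))
    (by
      intro p hp p' hp' e he
      have hp := hfin.mem_toFinset.1 hp
      have hp' := hfin.mem_toFinset.1 hp'
      have he0 : e ≠ 0 := by
        rintro rfl
        exact hτ p hp (by rw [he, zero_smul])
      have h1 := hrep p hp
      rw [he, evalAt_smul m.homogeneous] at h1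
      exact h1.eq ((hrep p' hp').smul (pow_ne_zero _ he0)))
    (fun p hp => hWτ p (hfin.mem_toFinset.1 hp))
    (by
      intro p hp
      have hp := hfin.mem_toFinset.1 hp
      refine hdet _ ⟨_, ⟨p, hp, _, hrep p hp, represents_mk (m.base_point_free _ (hτ p hp))⟩, ?_⟩
      rw [m.evalAt_projection]
      exact represents_mk _)
  -- A row completing `A` to an invertible matrix yields a form `η` whose determinant is a nonzero
  -- multiple of that of `f`; it serves to cancel the determinant of `h`.
  obtain ⟨b, hb⟩ : ∃ b : Fin 4 → ℂ,
      b ∉ Submodule.span ℂ (Set.range (coordRows A)) := by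
    by_contra! hall
    have htop : Submodule.span ℂ (Set.range (coordRows A)) = ⊤ :=
      Submodule.eq_top_iff'.2 hall
    have h1 := finrank_range_le_card (R := ℂ) (coordRows A)
    rw [Set.finrank, htop, finrank_top] at h1
    simp at h1
  set g : Matrix (Fin 4) (Fin 4) ℂ := addRow (coordRows A) b with hg
  have hg0 : g.det ≠ 0 := ((Matrix.isUnit_iff_isUnit_det g).1
    (isUnit_addRow (linearIndependent_coordRows m.surjective) hb)).ne_zero
  set η : MvPolynomial (Fin 2) ℂ := ∑ j, b j • f j with hη
  have hηdet : (thirdDerivMatrix (extend H η)).det = g.det • (thirdDerivMatrix f).det := by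
    rw [hη, extend_eq_combination m.projection, det_thirdDerivMatrix_mul, smul_eq_C_mul]
  have hηhom : η.IsHomogeneous d := IsHomogeneous.sum _ _ _ fun j _ =>
    (homogeneousSubmodule (Fin 2) ℂ d).smul_mem _ (m.homogeneous j)
  have hzero : (thirdDerivMatrix (extend H (h + (-(c / g.det)) • η))).det = 0 := by
    rw [det_add, det_smul, hηdet, hc, smul_smul, neg_mul, div_mul_cancel₀ _ hg0, neg_smul,
      add_neg_cancel]
  have hdep := not_linearIndependent_of_det_eq_zero m.three_le
    (extend_isHomogeneous m.projection_isHomogeneous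
      (hh.add ((homogeneousSubmodule (Fin 2) ℂ d).smul_mem _ hηhom))) hzero
  rw [extend_eq_snoc, linearIndependent_finSnoc, not_and_not_right] at hdep
  have hspan := hdep m.linearIndependent_projection
  have hle : Submodule.span ℂ (Set.range H) ≤ LinearMap.range (Fintype.linearCombination ℂ f) := by
    rw [Submodule.span_le]
    rintro _ ⟨i, rfl⟩
    exact ⟨coordRows A i, (m.projection i).symm⟩
  have hηmem : η ∈ LinearMap.range (Fintype.linearCombination ℂ f) := ⟨b, rfl⟩
  have := Submodule.sub_mem _ (hle hspan) (Submodule.smul_mem _ (-(c / g.det)) hηmem)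
  rwa [add_sub_cancel_right] at this

theorem solutionSpace_eq (m : MarkedProjection d f P A H) :
    solutionSpace d H (projImage A P) = LinearMap.range (Fintype.linearCombination ℂ f) := by
  refine m.solutionSpace_le.antisymm ?_
  rintro _ ⟨b, rfl⟩
  exact m.combination_mem_solutionSpace b

theorem finrank_solutionSpace (m : MarkedProjection d f P A H) :
    Module.finrank ℂ (solutionSpace d H (projImage A P)) = 4 := by
  rw [m.solutionSpace_eq, LinearMap.finrank_range_of_inj
    m.linearIndependent.fintypeLinearCombination_injective]
  simp

/-- Write `h = ∑ b j • f j`. As `h` is outside the span of `H`, the row `b` completes `A` to an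
invertible matrix, and this matrix carries `f` to `(H, h)`. -/
theorem exists_transform (m : MarkedProjection d f P A H) {h : MvPolynomial (Fin 2) ℂ}
    (hh : h ∈ solutionSpace d H (projImage A P)) (hH : h ∉ Submodule.span ℂ (Set.range H)) :
    ∃ g : (Fin 4 → ℂ) ≃ₗ[ℂ] (Fin 4 → ℂ), (∀ (v : Fin 4 → ℂ) (i : Fin 3), g v i.castSucc = A v i) ∧
      transform g (curve (n := 3) f) = curve (n := 3) (extend H h) ∧
      transform g (tangentDevelopable (n := 3) f) =
        tangentDevelopable (n := 3) (extend H h) := by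
  obtain ⟨b, rfl⟩ := m.solutionSpace_le hh
  set M : Matrix (Fin 4) (Fin 4) ℂ := addRow (coordRows A) b with hM
  have hb : b ∉ Submodule.span ℂ (Set.range (coordRows A)) := by
    intro hb
    apply hH
    have h1 := Submodule.mem_map_of_mem (f := Fintype.linearCombination ℂ f) hb
    rw [Submodule.map_span, ← Set.range_comp] at h1
    convert h1 using 3
    funext i
    exact m.projection i
  have hunit : IsUnit M := isUnit_addRow (linearIndependent_coordRows m.surjective) hb
  have hinj : Function.Injective M.mulVec := Matrix.mulVec_injective_of_isUnit hunit
  let g : (Fin 4 → ℂ) ≃ₗ[ℂ] (Fin 4 → ℂ) :=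
    LinearMap.linearEquivOfInjective (Matrix.mulVecLin M) hinj rfl
  have hg : ∀ v, g v = M.mulVec v := fun v => rfl
  have hext : extend H (Fintype.linearCombination ℂ f b) = fun i => ∑ j, M i j • f j :=
    extend_eq_combination m.projection b
  refine ⟨g, ?_, ?_, ?_⟩
  · intro v i
    rw [hg, ← sum_coordRows]
    simp only [Matrix.mulVec, dotProduct, hM, addRow_castSucc]
  · rw [hext]
    exact transform_curve fun τ => evalAt_combination (m := 3) (n := 3) M f τ
  · rw [hext]
    exact transform_tangentDevelopable fun k τ => partialAt_combination (m := 3) (n := 3) M f k τ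

end MarkedProjection

/-- The surface of bad centres of projection: a union of cones over the curve. -/
theorem exists_union_of_cones {d : ℕ} (hd : d ≠ 0) {γ : Fin 4 → MvPolynomial (Fin 2) ℂ}
    (hγ : ∀ i, (γ i).IsHomogeneous d) (s : Finset (PSpace 3)) :
    ∃ (G : MvPolynomial (Fin 4) ℂ) (k : ℕ), G ≠ 0 ∧ G.IsHomogeneous k ∧
      ∀ p ∈ s, ∀ (w : Fin 4 → ℂ) (τ : Fin 2 → ℂ) (c : ℂ), Represents (n := 3) w p →
        eval (evalAt (n := 3) γ τ - c • w) G = 0 := by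
  choose G k hG0 hG hGev using fun p : PSpace 3 => exists_cone hd hγ p.rep p.rep_nonzero
  refine ⟨∏ p ∈ s, G p, ∑ p ∈ s, k p, Finset.prod_ne_zero_iff.2 fun p _ => hG0 p,
    IsHomogeneous.prod _ _ _ fun p _ => hG p, ?_⟩
  intro p hp w τ c hw
  obtain ⟨e, -, rfl⟩ := represents_iff.1 hw
  rw [map_prod]
  refine Finset.prod_eq_zero hp ?_
  rw [smul_smul]
  exact hGev p τ (c * e)

end TangentDev

/-! ### Choice of the centre and reduction to a marked projection -/

theorem mainTheorem2 (d : ℕ) (hd : 3 ≤ d) (γ : Fin 4 → MvPolynomial (Fin 2) ℂ)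
    (hγ : TangentDev.IsGood d γ) :
    -- the centre of projection is general: it lies off the surface `G = 0`
    ∃ (G : MvPolynomial (Fin 4) ℂ) (k : ℕ), G ≠ 0 ∧ G.IsHomogeneous k ∧
      ∀ A : (Fin 4 → ℂ) →ₗ[ℂ] (Fin 3 → ℂ), Function.Surjective A →
        (∀ v : Fin 4 → ℂ, A v = 0 → v ≠ 0 → MvPolynomial.eval v G ≠ 0) →
        ∀ H : Fin 3 → MvPolynomial (Fin 2) ℂ,
          TangentDev.IsParametrization (n := 2) d H →
          TangentDev.curve (n := 2) H =
            TangentDev.projImage A (TangentDev.curve (n := 3) γ) →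
          (TangentDev.projImage A (TangentDev.cuspidalPinchPoints γ)).encard =
            ((4 * (d - 3) : ℕ) : ℕ∞) ∧
          Module.finrank ℂ (TangentDev.solutionSpace d H
            (TangentDev.projImage A (TangentDev.cuspidalPinchPoints γ))) = 4 ∧
          ∀ h ∈ TangentDev.solutionSpace d H
              (TangentDev.projImage A (TangentDev.cuspidalPinchPoints γ)),
            h ∉ Submodule.span ℂ (Set.range H) →
            ∃ g : (Fin 4 → ℂ) ≃ₗ[ℂ] (Fin 4 → ℂ),
              (∀ (v : Fin 4 → ℂ) (i : Fin 3), g v i.castSucc = A v i) ∧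
              TangentDev.transform g (TangentDev.curve (n := 3) γ) =
                TangentDev.curve (n := 3) (TangentDev.extend H h) ∧
              TangentDev.transform g (TangentDev.tangentDevelopable (n := 3) γ) =
                TangentDev.tangentDevelopable (n := 3) (TangentDev.extend H h) := by
  classical
  have hd0 : d ≠ 0 := by omega
  have hhom := hγ.parametrization.homogeneous
  have hfin : (TangentDev.cuspidalPinchPoints γ).Finite :=
    Set.finite_of_encard_eq_coe hγ.card_pinch
  -- An arbitrary extra vertex. Every cone contains `C`, so the centre avoids `C` even for `d = 3`,
  -- when there are no pinch points.
  set p₀ : TangentDev.PSpace 3 := Projectivization.mk ℂ (fun _ => 1)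
    fun h => one_ne_zero (congrFun h 0) with hp₀
  obtain ⟨G, k, hG0, hG, hGev⟩ :=
    TangentDev.exists_union_of_cones hd0 hhom (insert p₀ hfin.toFinset)
  refine ⟨G, k, hG0, hG, ?_⟩
  intro A hA hAG H hH hcurve
  have hsep : ∀ p ∈ insert p₀ hfin.toFinset, ∀ (w : Fin 4 → ℂ) (τ : Fin 2 → ℂ) (c : ℂ),
      TangentDev.Represents (n := 3) w p →
      A (TangentDev.evalAt (n := 3) γ τ) = c • A w → TangentDev.evalAt (n := 3) γ τ = c • w := by
    intro p hp w τ c hw h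
    by_contra hne
    -- The difference would be a nonzero vector of the centre lying on a cone.
    refine hAG _ ?_ (sub_ne_zero.2 hne) (hGev p hp w τ c hw)
    rw [map_sub, map_smul, h, sub_self]
  have hbase : ∀ τ : Fin 2 → ℂ, τ ≠ 0 → A (TangentDev.evalAt (n := 3) γ τ) ≠ 0 := by
    intro τ hτ h
    refine hγ.parametrization.base_point_free τ hτ ?_
    rw [hsep p₀ (Finset.mem_insert_self _ _) _ τ 0 (TangentDev.represents_rep p₀)
      (by rw [h, zero_smul]), zero_smul]
  set K : Fin 3 → MvPolynomial (Fin 2) ℂ :=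
    fun i => ∑ j, TangentDev.coordRows A i j • γ j with hK
  have hKev : ∀ τ, TangentDev.evalAt (n := 2) K τ = A (TangentDev.evalAt (n := 3) γ τ) := by
    intro τ
    ext i
    rw [← TangentDev.sum_coordRows]
    simp only [TangentDev.evalAt, hK, map_sum, MvPolynomial.smul_eval]
  obtain ⟨M, hM, hKM⟩ := TangentDev.exists_linSub_eq (n := 2) hd0 hH (K := K)
    (fun i => MvPolynomial.IsHomogeneous.sum _ _ _ fun j _ =>
      (MvPolynomial.homogeneousSubmodule (Fin 2) ℂ d).smul_mem _ (hhom j))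
    (fun τ hτ => by rw [hKev]; exact hbase τ hτ)
    (by
      rintro q ⟨τ, hτ, hq⟩
      rw [hcurve]
      rw [hKev] at hq
      have h0 := hγ.parametrization.base_point_free τ hτ
      exact ⟨_, ⟨τ, hτ, TangentDev.represents_mk h0⟩, _, TangentDev.represents_mk h0, hq⟩)
  have hM' : IsUnit M⁻¹.det := Matrix.isUnit_nonsing_inv_det M hM
  -- Reparametrizing `γ` by `M⁻¹` changes neither the curve nor its tangent developable, and makes
  -- `H` literally the projection of `f`.
  set f : Fin 4 → MvPolynomial (Fin 2) ℂ := fun i => TangentDev.linSub M⁻¹ (γ i) with hf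
  have hcurve_f : TangentDev.curve (n := 3) f = TangentDev.curve (n := 3) γ :=
    TangentDev.curve_linSub (n := 3) γ hM'
  have hdev_f : TangentDev.tangentDevelopable (n := 3) f = TangentDev.tangentDevelopable (n := 3) γ :=
    TangentDev.tangentDevelopable_linSub (n := 3) γ hM'
  have hfev : ∀ τ, TangentDev.evalAt (n := 3) f τ =
      TangentDev.evalAt (n := 3) γ (M⁻¹.mulVec τ) := TangentDev.evalAt_linSub (n := 3) γ M⁻¹
  have hfhom : ∀ i, (f i).IsHomogeneous d := fun i => TangentDev.linSub_isHomogeneous _ (hhom i)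
  have hinv : ∀ F, TangentDev.linSub M⁻¹ (TangentDev.linSub M F) = F := by
    have := TangentDev.linSub_linSub_inv hM'
    rwa [Matrix.nonsing_inv_nonsing_inv _ hM] at this
  have hm : TangentDev.MarkedProjection d f (TangentDev.cuspidalPinchPoints γ) A H := by
    refine ⟨hd, hfhom, ?_, ?_, hγ.card_pinch, ?_, hA, ?_, ?_, ?_⟩
    · have hinj : Function.Injective (TangentDev.linSub M⁻¹) :=
        Function.LeftInverse.injective (TangentDev.linSub_linSub_inv hM)
      exact hγ.nondegenerate.map' (TangentDev.linSub M⁻¹).toLinearMap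
        (LinearMap.ker_eq_bot.2 hinj)
    · intro τ τ' p hτ hτ' h h'
      rw [hfev] at h h'
      obtain ⟨c, hc⟩ := hγ.cuspidal_smooth.exists_smul (n := 3) hhom
        (TangentDev.mulVec_ne_zero hM' hτ) (TangentDev.mulVec_ne_zero hM' hτ') h h'
      refine ⟨c, ?_⟩
      have := congrArg M.mulVec hc
      rwa [Matrix.mulVec_smul, Matrix.mulVec_mulVec, Matrix.mulVec_mulVec,
        Matrix.mul_nonsing_inv _ hM, Matrix.one_mulVec, Matrix.one_mulVec] at this
    · rintro p ⟨Φ, hΦ, hS, hC, -⟩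
      -- The origin satisfies `x = y = 0`, so the pinch point lies on `C`.
      obtain ⟨p', hp', hrep⟩ := hC.self_of_nhds.2 ⟨rfl, rfl⟩
      rw [← hΦ.center.eq hrep, ← hcurve_f] at hp'
      obtain ⟨τ, hτ, hτp⟩ := hp'
      rw [← hdev_f] at hS
      rw [← hcurve_f] at hC
      exact ⟨τ, hτ, hτp, TangentDev.det_eq_zero_of_pinch hd0 hfhom hτ hτp hΦ hS hC⟩
    · intro τ hτ
      rw [hfev]
      exact hbase _ (TangentDev.mulVec_ne_zero hM' hτ)
    · intro p hp w τ c hτ hw h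
      rw [hfev] at h ⊢
      exact hsep p (Finset.mem_insert_of_mem (hfin.mem_toFinset.2 hp)) w _ c hw h
    · intro i
      rw [← hinv (H i), ← hKM i, hK, map_sum]
      simp only [map_smul, hf]
  refine ⟨hm.encard_projImage, hm.finrank_solutionSpace, fun h hh hspan => ?_⟩
  obtain ⟨g, h1, h2, h3⟩ := hm.exists_transform hh hspan
  rw [hcurve_f] at h2
  rw [hdev_f] at h3
  exact ⟨g, h1, h2, h3⟩
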